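/- **Setting.** An \emph{$st$-graph} is a finite loopless graph $G$ (parallel edges allowed) with two distinct vertices $s,t$ (the \emph{poles}) such that $G+st$ is biconnected and planar. Every edge $e$ has a \emph{flexibility} $\mathrm{flex}(e)\in\{0,1,2,\dots\}$; an edge with $\mathrm{flex}(e)=0$ is \emph{inflexible}. An inflexible edge is \emph{critical} if it has an endpoint of degree $4$, or an endpoint that is a pole of degree at least $2$ in $G$. $G$ is \emph{$k$-critical} if it has exactly $k$ critical edges. An \emph{orthogonal representation} $\mathcal R$ of $G$ is a planar embedding of $G$ with $s$ and $t$ on the outer face, together with an integer $\mathrm{rot}(e_f)$ for every incidence of an edge $e$ with a face $f$ and an integer $\mathrm{rot}(v_f)\in[-2,1]$ for every incidence (angle) of a vertex $v$ with a face $f$, such that (1) the rotations of all edges and vertices in a face sum up to $4$, and to $-4$ in the outer face; (2) the two rotations of each edge sum up to $0$; (3) the rotations around each vertex $v$ sum up to $2\deg(v)-4$. It is \emph{valid} if $|\mathrm{rot}(e_f)|\le\mathrm{flex}(e)$ for every edge $e$ and incident face $f$. It is a \emph{$(\sigma,\tau)$-orthogonal representation} if the rotations of $s$ and $t$ in the outer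 face are $\sigma-3$ and $\tau-3$. Let $\pi(s,t)$ and $\pi(t,s)$ be the paths from $s$ to $t$ and from $t$ to $s$ obtained by traversing the outer face counterclockwise; the rotation $\mathrm{rot}(\pi)$ of such a path is the sum of the rotations, in the outer face, of its edges and internal vertices. The \emph{number of bends} of $\mathcal R$ is $\max\{|\mathrm{rot}(\pi(s,t))|,|\mathrm{rot}(\pi(t,s))|\}$. Let $\mathcal B^\sigma_\tau$ be the set of all $\beta$ such that $G$ admits a valid $(\sigma,\tau)$-orthogonal representation with $\beta$ bends, and let $\beta_{\mathrm{low}}=\lceil(\sigma+\tau)/2\rceil-1$. If $\mathcal B^\sigma_\tau\neq\emptyset$, let $\beta_{\max}$ be its maximum and let $\beta\in\mathcal B^\sigma_\tau$ be the smallest element such that every integer in $[\beta,\beta_{\max}]$ lies in $\mathcal B^\sigma_\tau$; the \emph{$(\sigma,\tau)$-gap} of $G$ is $\beta-\beta_{\mathrm{low}}$. **Statement.** Let $G$ be a $k$-critical $st$-graph and suppose that $\mathcal B^\sigma_\tau\ne\emptyset$. Then $\beta_{\max}$ and the $(\sigma,\tau)$-gap exist, and: 1. if $\sigma+\tau\le5$,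 the $(\sigma,\tau)$-gap of $G$ is at most $k$; in particular every integer in $[\beta_{\mathrm{low}}+k,\beta_{\max}]$ lies in $\mathcal B^\sigma_\tau$; 2. if $\sigma=\tau=3$, the $(3,3)$-gap of $G$ is at most $k+1$; in particular every integer in $[\beta_{\mathrm{low}}+k+1,\beta_{\max}]$ lies in $\mathcal B^3_3$. -/

import Mathlib

namespace Graph

variable {V E : Type*}

/-! ### Connectivity, degree, adding an edge -/

/-- A graph is connected if it has a vertex and any two of its vertices are joined by a path. -/
def IsConnected (G : Graph V E) : Prop :=
  G.vertexSet.Nonempty ∧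
    ∀ x ∈ G.vertexSet, ∀ y ∈ G.vertexSet, Relation.ReflTransGen G.Adj x y

/-- A cutvertex is a vertex whose removal leaves two vertices that are not joined by a path. -/
def IsCutvertex (G : Graph V E) (v : V) : Prop :=
  v ∈ G.vertexSet ∧
    ∃ x ∈ (G.deleteVerts {v}).vertexSet, ∃ y ∈ (G.deleteVerts {v}).vertexSet,
      ¬ Relation.ReflTransGen (G.deleteVerts {v}).Adj x y

/-- A graph is biconnected if it is connected and has no cutvertex. -/
def IsBiconnected (G : Graph V E) : Prop :=
  G.IsConnected ∧ ∀ v, ¬ G.IsCutvertex v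

/-- The degree of a vertex of a loopless graph: the number of edges incident to it. -/
noncomputable def deg (G : Graph V E) (v : V) : ℕ :=
  (G.incidenceSet v).ncard

/-- The graph `G + st`: the new edge `none` joins `s` and `t`.
It is parallel to the edges between `s` and `t` that `G` already has, if any. -/
def addNewEdge (G : Graph V E) (s t : V) : Graph V (Option E) where
  vertexSet := G.vertexSet ∪ {s, t}
  IsLink e x y :=
    match e with
    | some e => G.IsLink e x y
    | none => (x = s ∧ y = t) ∨ (x = t ∧ y = s)
  isLink_symm := by
    rintro (_ | e) -
    · constructor
      rintro x y (⟨rfl, rfl⟩ | ⟨rfl, rfl⟩) <;> simp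
    · constructor
      intro x y h
      exact h.symm
  eq_or_eq_of_isLink_of_isLink := by
    rintro (_ | e) x y v w h h'
    · simp only at h h'
      grind
    · exact h.left_eq_or_eq h'
  left_mem_of_isLink := by
    rintro (_ | e) x y h
    · simp only at h
      grind
    · exact Or.inl h.left_mem

/-! ### Planar embeddings

A planar embedding of a connected loopless multigraph is described by the cyclic orders of the
edges around the vertices (a rotation system) such that Euler's formula holds. -/

/-- A dart is an edge together with one of its two directions (from `fst` to `snd`). In a loopless
graph, every edge gives exactly two darts. -/
@[ext]
structure Dart (G : Graph V E) where
  edge : E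
  fst : V
  snd : V
  isLink : G.IsLink edge fst snd

namespace Dart

variable {G : Graph V E}

/-- The dart of the same edge in the opposite direction. -/
def rev (d : G.Dart) : G.Dart := ⟨d.edge, d.snd, d.fst, d.isLink.symm⟩

/-- Reversing as a permutation of the darts. -/
def revPerm (G : Graph V E) : Equiv.Perm G.Dart where
  toFun := rev
  invFun := rev
  left_inv _ := rfl
  right_inv _ := rfl

instance [Finite V] [Finite E] : Finite G.Dart :=
  Finite.of_injective (fun d : G.Dart => (d.edge, d.fst, d.snd)) fun a b h => by
    simp only [Prod.mk.injEq] at h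
    exact Dart.ext h.1 h.2.1 h.2.2

noncomputable instance [Finite V] [Finite E] : Fintype G.Dart := Fintype.ofFinite _

end Dart

/-- A rotation system: `next` maps every dart to the next dart in counterclockwise order around its
initial vertex, so that the cycles of `next` are exactly the sets of darts leaving one vertex. -/
structure RotationSystem (G : Graph V E) where
  next : Equiv.Perm G.Dart
  sameCycle_iff : ∀ d d' : G.Dart, next.SameCycle d d' ↔ d.fst = d'.fst

namespace RotationSystem

variable {G : Graph V E}

/-- The boundary of the face to the right of the dart `d` continues with `succ d`: at the end of
`d` turn back and take the next dart in counterclockwise order. So an inner face is traversed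
clockwise and the outer face counterclockwise. -/
def succ (M : G.RotationSystem) : Equiv.Perm G.Dart := M.next * Dart.revPerm G

/-- The faces are the cycles of `succ`. -/
def Face (M : G.RotationSystem) : Type _ := Quotient (Equiv.Perm.SameCycle.setoid M.succ)

/-- The face to the right of a dart. -/
def face (M : G.RotationSystem) (d : G.Dart) : M.Face :=
  Quotient.mk (Equiv.Perm.SameCycle.setoid M.succ) d

end RotationSystem

/-- An embedding of a connected graph in the sphere: a rotation system of genus zero. -/
structure PlanarEmbedding (G : Graph V E) extends RotationSystem G where
  connected : G.IsConnected
  euler : Nat.card G.vertexSet + Nat.card toRotationSystem.Face = Nat.card G.edgeSet + 2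

/-- A connected loopless graph with at least one edge is planar if it has a planar embedding. -/
def IsPlanar (G : Graph V E) : Prop := Nonempty G.PlanarEmbedding

/-- `G` is an `st`-graph with poles `s` and `t`: it is a loopless graph containing the two
distinct vertices `s` and `t`, and `G + st` is biconnected and planar. -/
structure IsStGraph (G : Graph V E) (s t : V) : Prop where
  loopless : G.Loopless
  left_mem : s ∈ G.vertexSet
  right_mem : t ∈ G.vertexSet
  ne : s ≠ t
  biconnected : (G.addNewEdge s t).IsBiconnected
  planar : (G.addNewEdge s t).IsPlanar

/-! ### Orthogonal representations -/

open Classical in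
/-- An orthogonal representation of the `st`-graph `G` with both poles on the outer face.

For a dart `d` with the face `f` to its right, `edgeRot d` is the rotation in `f` of the edge of
`d`, and `vertexRot d` is the rotation in `f` of the initial vertex of `d`, at the corner between
`d` and the dart that precedes it on the boundary of `f`. -/
structure OrthogonalRepresentation [Finite V] [Finite E] (G : Graph V E) (s t : V)
    extends PlanarEmbedding G where
  outer : toRotationSystem.Face
  edgeRot : G.Dart → ℤ
  vertexRot : G.Dart → ℤ
  /-- The rotations in a face sum up to `4`, and to `-4` in the outer face. -/
  sum_face : ∀ f : toRotationSystem.Face,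
    ∑ d : G.Dart with toRotationSystem.face d = f, (edgeRot d + vertexRot d) =
      if f = outer then -4 else 4
  /-- The two rotations of an edge cancel. -/
  edgeRot_rev : ∀ d : G.Dart, edgeRot d + edgeRot d.rev = 0
  /-- The rotations around a vertex `v` sum up to `2 * deg v - 4`. -/
  sum_vertex : ∀ v ∈ G.vertexSet,
    ∑ d : G.Dart with d.fst = v, vertexRot d = 2 * (G.deg v : ℤ) - 4
  /-- The rotations at vertices lie in the range from `-2` to `1`. -/
  vertexRot_mem : ∀ d : G.Dart, vertexRot d ∈ Set.Icc (-2) 1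
  /-- The poles lie on the outer face; `sOut` and `tOut` are the darts that leave `s` and `t` on
  its boundary. (They are unique, as a pole of an `st`-graph is not a cutvertex.) -/
  sOut : G.Dart
  tOut : G.Dart
  sOut_fst : sOut.fst = s
  tOut_fst : tOut.fst = t
  face_sOut : toRotationSystem.face sOut = outer
  face_tOut : toRotationSystem.face tOut = outer

namespace OrthogonalRepresentation

variable [Finite V] [Finite E] {G : Graph V E} {s t : V}

/-- The number of edges on the way along the boundary of a face from the initial vertex of `d` to
the initial vertex of `d'`. -/
noncomputable def dist (R : G.OrthogonalRepresentation s t) (d d' : G.Dart) : ℕ :=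
  sInf {n : ℕ | (R.succ ^ n) d = d'}

/-- The rotation of the path along the boundary of a face from the initial vertex of `d` to the
initial vertex of `d'`: the sum of the rotations of its edges and of its internal vertices. -/
noncomputable def pathRot (R : G.OrthogonalRepresentation s t) (d d' : G.Dart) : ℤ :=
  ∑ i ∈ Finset.range (R.dist d d'), R.edgeRot ((R.succ ^ i) d) +
    ∑ i ∈ Finset.Ico 1 (R.dist d d'), R.vertexRot ((R.succ ^ i) d)

/-- The rotation of `π(s, t)`, the path from `s` to `t` when traversing the outer face in
counterclockwise direction. -/
noncomputable def rotST (R : G.OrthogonalRepresentation s t) : ℤ := R.pathRot R.sOut R.tOut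

/-- The rotation of `π(t, s)`. -/
noncomputable def rotTS (R : G.OrthogonalRepresentation s t) : ℤ := R.pathRot R.tOut R.sOut

/-- The number of bends of an orthogonal representation. -/
noncomputable def bends (R : G.OrthogonalRepresentation s t) : ℤ := max |R.rotST| |R.rotTS|

/-- `R` is a `(σ, τ)`-orthogonal representation: `s` and `t` have `σ` and `τ` occupied
incidences. -/
def HasType (R : G.OrthogonalRepresentation s t) (σ τ : ℕ) : Prop :=
  R.vertexRot R.sOut = (σ : ℤ) - 3 ∧ R.vertexRot R.tOut = (τ : ℤ) - 3

/-- `R` is valid if no edge has more bends than its flexibility. -/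
def IsValid (R : G.OrthogonalRepresentation s t) (flex : E → ℕ) : Prop :=
  ∀ d : G.Dart, |R.edgeRot d| ≤ (flex d.edge : ℤ)

end OrthogonalRepresentation

/-! ### Critical edges and the gap -/

/-- An edge of an `st`-graph is critical if it is inflexible and has an endpoint that has
degree 4, or that is a pole and has degree at least 2. -/
def IsCritical (G : Graph V E) (s t : V) (flex : E → ℕ) (e : E) : Prop :=
  e ∈ G.edgeSet ∧ flex e = 0 ∧
    ∃ v, G.Inc e v ∧ (G.deg v = 4 ∨ ((v = s ∨ v = t) ∧ 2 ≤ G.deg v))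

/-- `G` contains exactly `k` critical edges. -/
def IsKCritical (G : Graph V E) (s t : V) (flex : E → ℕ) (k : ℕ) : Prop :=
  {e | G.IsCritical s t flex e}.ncard = k

/-- The set of all `β` such that `G` admits a valid `(σ, τ)`-orthogonal representation with `β`
bends. -/
def bendSet [Finite V] [Finite E] (G : Graph V E) (s t : V) (flex : E → ℕ) (σ τ : ℕ) : Set ℤ :=
  {β | ∃ R : G.OrthogonalRepresentation s t, R.IsValid flex ∧ R.HasType σ τ ∧ R.bends = β}

/-- The lower bound `⌈(σ + τ) / 2⌉ - 1` on the number of bends of a `(σ, τ)`-orthogonal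
representation. -/
def betaLow (σ τ : ℕ) : ℤ := ⌈((σ : ℚ) + (τ : ℚ)) / 2⌉ - 1

/-- The maximum bend value. -/
noncomputable def betaMax [Finite V] [Finite E] (G : Graph V E) (s t : V) (flex : E → ℕ)
    (σ τ : ℕ) : ℤ :=
  sSup (G.bendSet s t flex σ τ)

/-- The attainable bend values from which on all integers up to the maximum bend value are
attainable. -/
def fullSet [Finite V] [Finite E] (G : Graph V E) (s t : V) (flex : E → ℕ) (σ τ : ℕ) : Set ℤ :=
  {β | β ∈ G.bendSet s t flex σ τ ∧
    Set.Icc β (G.betaMax s t flex σ τ) ⊆ G.bendSet s t flex σ τ}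

/-- The `(σ, τ)`-gap of `G`: the difference between the smallest attainable bend value from which
on all integers up to the maximum are attainable, and the lower bound. -/
noncomputable def gap [Finite V] [Finite E] (G : Graph V E) (s t : V) (flex : E → ℕ)
    (σ τ : ℕ) : ℤ :=
  sInf (G.fullSet s t flex σ τ) - betaLow σ τ

end Graph

/-!
Take a valid representation in which `π(s, t)` has the smaller rotation; the other case is
symmetric. Since the two paths have total rotation `2 - σ - τ`, the number of bends is
`-rot(π(s, t))`, and it drops by one if one unit of rotation is moved from `π(t, s)` to `π(s, t)`
while the embedding is kept. Split the outer face into its sides along the two paths. A unit can be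
moved between two faces across an edge that is not bent to its flexibility, and between two
consecutive angles of a vertex that are not at their limits. If a chain of such moves leads from one
side of the outer face to the other, a shortest one can be carried out
(`OrthogonalRepresentation.exists_augmentation`).

Otherwise let `X` be the set of faces that are reachable from the side along `π(s, t)`. The edges on
the boundary of `X` are bent as far as their flexibility admits, and at a vertex other than the
poles with angles inside and outside of `X`, all angles inside have rotation `1`. Adding up the
rotations in all faces of `X` bounds `-rot(π(s, t))` from above
(`OrthogonalRepresentation.neg_rotST_le`). Three ingredients enter.

* Interior vertices, edges and faces of `X` contribute four times their Euler characteristic, which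
  is at most `1` because `X` is connected and misses a face: the edges of a dual spanning tree of
  `X` can be deleted without disconnecting the graph (`OrthogonalRepresentation.exists_dual_tree`),
  and every interior vertex is the end of its own remaining edge
  (`OrthogonalRepresentation.card_fullVerts_le`). So no Jordan curve argument is needed.
* A boundary vertex contributes a sharp turn only if it has degree `4`. Then the boundary edges
  at it either have a bend in the opposite direction or are critical
  (`OrthogonalRepresentation.vertex_bound`).
* The angles at the poles contribute at most `σ - 1` and `τ - 1`, and one boundary edge at a pole of
  degree at least `2` remains unused.

So the number of bends is at most `k + max 0 (σ + τ - 3)` when no reduction is possible, which the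
lower bound on the number of bends turns into the bounds on the gap.
-/

namespace Graph

/-! ### Arcs of a cycle of a permutation -/

section Arc

variable {D : Type*} (f : Equiv.Perm D) (x y : D)

/-- The number of steps that `f` needs from `x` to `y`; the junk value `0` if `y` is not reached. -/
noncomputable def hitTime : ℕ := sInf {n : ℕ | (f ^ n) x = y}

open Classical in
/-- The elements on the way from `x` (included) to `y` (excluded) under iteration of `f`. -/
noncomputable def arc : Finset D := (Finset.range (hitTime f x y)).image fun i => (f ^ i) x

variable {f x y}

lemma pow_hitTime [Finite D] (h : f.SameCycle x y) : (f ^ hitTime f x y) x = y :=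
  Nat.sInf_mem (s := {n : ℕ | (f ^ n) x = y}) h.exists_nat_pow_eq

lemma hitTime_le {n : ℕ} (h : (f ^ n) x = y) : hitTime f x y ≤ n :=
  Nat.sInf_le (s := {n : ℕ | (f ^ n) x = y}) h

lemma hitTime_pos [Finite D] (h : f.SameCycle x y) (hne : x ≠ y) : 0 < hitTime f x y := by
  rcases Nat.eq_zero_or_pos (hitTime f x y) with h0 | h0
  · have := pow_hitTime h
    rw [h0] at this
    exact absurd this hne
  · exact h0

lemma mem_arc {z : D} : z ∈ arc f x y ↔ ∃ i < hitTime f x y, (f ^ i) x = z := by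
  simp [arc]

lemma pow_injOn_hitTime [Finite D] (h : f.SameCycle x y) :
    Set.InjOn (fun i => (f ^ i) x) (Finset.range (hitTime f x y) : Set ℕ) := by
  have key : ∀ i j, i < j → j < hitTime f x y → (f ^ i) x ≠ (f ^ j) x := by
    intro i j hij hj he
    have h1 : (f ^ (j - i)) x = x := by
      apply (f ^ i).injective
      rw [← Equiv.Perm.mul_apply, ← pow_add, Nat.add_sub_cancel' hij.le, he]
    have h2 : (f ^ (hitTime f x y - (j - i))) x = y := by
      have h3 : hitTime f x y = hitTime f x y - (j - i) + (j - i) := by omega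
      have h4 := pow_hitTime h
      rwa [h3, pow_add, Equiv.Perm.mul_apply, h1] at h4
    have := hitTime_le h2
    omega
  intro i hi j hj he
  simp only [Finset.coe_range, Set.mem_Iio] at hi hj
  rcases lt_trichotomy i j with hlt | heq | hlt
  · exact absurd he (key i j hlt hj)
  · exact heq
  · exact absurd he.symm (key j i hlt hi)

lemma hitTime_lt_of_periodic [Finite D] (h : f.SameCycle x y) {m : ℕ} (hm : 0 < m)
    (hx : (f ^ m) x = x) : hitTime f x y < m := by
  have h1 : (f ^ (hitTime f x y % m)) x = y := by
    have h2 : ∀ n : ℕ, ((f ^ m) ^ n) x = x := by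
      intro n
      induction n with
      | zero => rfl
      | succ n ih => rw [pow_succ, Equiv.Perm.mul_apply, hx, ih]
    have h3 := pow_hitTime h
    conv_lhs at h3 => rw [← Nat.mod_add_div (hitTime f x y) m]
    rwa [pow_add, pow_mul, Equiv.Perm.mul_apply, h2] at h3
  exact (hitTime_le h1).trans_lt (Nat.mod_lt _ hm)

lemma disjoint_arc [Finite D] (h : f.SameCycle x y) : Disjoint (arc f x y) (arc f y x) := by
  rw [Finset.disjoint_left]
  intro z hz hz'
  obtain ⟨i, hi, rfl⟩ := mem_arc.1 hz
  obtain ⟨j, hj, he⟩ := mem_arc.1 hz'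
  have hp := pow_hitTime h
  have hq := pow_hitTime h.symm
  -- Each of the two points returns to itself by leaving along one arc and arriving along the other.
  have h1 : (f ^ (hitTime f x y - i + j)) y = y := by
    rw [pow_add, Equiv.Perm.mul_apply, he, ← Equiv.Perm.mul_apply, ← pow_add,
      Nat.sub_add_cancel hi.le, hp]
  have h2 : (f ^ (hitTime f y x - j + i)) x = x := by
    rw [pow_add, Equiv.Perm.mul_apply, ← he, ← Equiv.Perm.mul_apply, ← pow_add,
      Nat.sub_add_cancel hj.le, hq]
  have := hitTime_lt_of_periodic h.symm (by omega) h1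
  have := hitTime_lt_of_periodic h (by omega) h2
  omega

lemma left_mem_arc [Finite D] (h : f.SameCycle x y) (hne : x ≠ y) : x ∈ arc f x y :=
  mem_arc.2 ⟨0, hitTime_pos h hne, rfl⟩

lemma right_notMem_arc [Finite D] (h : f.SameCycle x y) (hne : x ≠ y) : y ∉ arc f x y :=
  fun hy => Finset.disjoint_left.1 (disjoint_arc h) hy (left_mem_arc h.symm hne.symm)

lemma apply_mem_arc [Finite D] (h : f.SameCycle x y) {z : D} (hz : z ∈ arc f x y) :
    f z = y ∨ f z ∈ arc f x y := by
  obtain ⟨i, hi, rfl⟩ := mem_arc.1 hz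
  rw [← Equiv.Perm.mul_apply, ← pow_succ']
  rcases (Nat.succ_le_of_lt hi).eq_or_lt with h1 | h1
  · left
    rw [← Nat.succ_eq_add_one, h1, pow_hitTime h]
  · right
    exact mem_arc.2 ⟨i + 1, h1, rfl⟩

lemma mem_arc_or_mem_arc [Finite D] (h : f.SameCycle x y) (hne : x ≠ y) {z : D}
    (hz : f.SameCycle x z) : z ∈ arc f x y ∨ z ∈ arc f y x := by
  obtain ⟨n, rfl⟩ := hz.exists_nat_pow_eq
  clear hz
  induction n with
  | zero => exact Or.inl (left_mem_arc h hne)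
  | succ n ih =>
    rw [pow_succ', Equiv.Perm.mul_apply]
    rcases ih with ih | ih
    · rcases apply_mem_arc h ih with h1 | h1
      · rw [h1]
        exact Or.inr (left_mem_arc h.symm hne.symm)
      · exact Or.inl h1
    · rcases apply_mem_arc h.symm ih with h1 | h1
      · rw [h1]
        exact Or.inl (left_mem_arc h hne)
      · exact Or.inr h1

lemma sameCycle_of_mem_arc {z : D} (hz : z ∈ arc f x y) : f.SameCycle x z := by
  obtain ⟨i, -, rfl⟩ := mem_arc.1 hz
  exact Equiv.Perm.sameCycle_pow_right.2 .rfl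

lemma exists_pow_apply_eq_self [Finite D] (d : D) :
    ∃ n, (f ^ n) (f d) = d ∧ ∀ i < n, (f ^ i) (f d) ≠ d := by
  have h : f.SameCycle (f d) d := Equiv.Perm.sameCycle_apply_left.2 .rfl
  exact ⟨hitTime f (f d) d, pow_hitTime h, fun i hi he => (hitTime_le he).not_gt hi⟩

end Arc

/-! ### Ranks and paths in a reachability relation -/

section Rank

/-- Breadth-first search: among the elements reachable from `a`, every one except `a` has a
predecessor of smaller rank. -/
lemma exists_rank {α : Type*} (r : α → α → Prop) (a : α) :
    ∃ rank : α → ℕ, ∀ b, Relation.ReflTransGen r a b → b ≠ a →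
      ∃ c, Relation.ReflTransGen r a c ∧ r c b ∧ rank c < rank b := by
  let S : ℕ → Set α := fun n => Nat.rec {a} (fun _ s => {b | b ∈ s ∨ ∃ c ∈ s, r c b}) n
  have hS0 : S 0 = {a} := rfl
  have hS : ∀ n, S (n + 1) = {b | b ∈ S n ∨ ∃ c ∈ S n, r c b} := fun _ => rfl
  have hreach : ∀ n, ∀ b ∈ S n, Relation.ReflTransGen r a b := by
    intro n
    induction n with
    | zero =>
      intro b hb
      rw [show b = a from hb]
    | succ n ih =>
      rintro b (hb | ⟨c, hc, hcb⟩)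
      · exact ih b hb
      · exact (ih c hc).tail hcb
  have hmem : ∀ b, Relation.ReflTransGen r a b → ∃ n, b ∈ S n := by
    intro b hb
    induction hb with
    | refl => exact ⟨0, rfl⟩
    | tail _ hcb ih =>
      obtain ⟨n, hn⟩ := ih
      exact ⟨n + 1, Or.inr ⟨_, hn, hcb⟩⟩
  refine ⟨fun b => sInf {n | b ∈ S n}, fun b hb hne => ?_⟩
  have hb' : b ∈ S (sInf {n | b ∈ S n}) := Nat.sInf_mem (s := {n | b ∈ S n}) (hmem b hb)
  rcases hn : sInf {n | b ∈ S n} with _ | n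
  · rw [hn] at hb'
    exact absurd hb' hne
  · rw [hn] at hb'
    have hbn : b ∉ S n := fun h => by
      have := Nat.sInf_le (s := {n | b ∈ S n}) h
      omega
    rcases hb' with h | ⟨c, hc, hcb⟩
    · exact absurd h hbn
    · exact ⟨c, hreach n c hc, hcb, by
        change sInf {n | c ∈ S n} < sInf {n | b ∈ S n}
        rw [hn]
        exact Nat.lt_succ_of_le (Nat.sInf_le hc)⟩

open Classical in
/-- If `b` can be reached from `a` by arcs with the property `U`, then there is a simple path of
such arcs. It is recorded as a set of arcs that leaves and enters each node at most once and whose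
net flow goes from `a` to `b`. -/
lemma exists_simple_path {A N : Type*} (src tgt : A → N) (U : A → Prop) {a b : N}
    (h : Relation.ReflTransGen (fun m n => ∃ x, U x ∧ src x = m ∧ tgt x = n) a b) :
    ∃ P : Finset A, (∀ x ∈ P, U x) ∧ Set.InjOn src P ∧ Set.InjOn tgt P ∧
      ∀ n, ((P.filter fun x => src x = n).card : ℤ) - (P.filter fun x => tgt x = n).card =
        (if n = a then 1 else 0) - if n = b then 1 else 0 := by
  obtain ⟨rank, hrank⟩ := exists_rank _ a
  suffices H : ∀ k b, rank b = k →
      Relation.ReflTransGen (fun m n => ∃ x, U x ∧ src x = m ∧ tgt x = n) a b →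
      ∃ P : Finset A, (∀ x ∈ P, U x ∧ rank (src x) < rank b ∧ rank (tgt x) ≤ rank b) ∧
        Set.InjOn src P ∧ Set.InjOn tgt P ∧
        ∀ n, ((P.filter fun x => src x = n).card : ℤ) - (P.filter fun x => tgt x = n).card =
          (if n = a then 1 else 0) - if n = b then 1 else 0 by
    obtain ⟨P, h1, h2⟩ := H _ b rfl h
    exact ⟨P, fun x hx => (h1 x hx).1, h2⟩
  intro k
  induction k using Nat.strong_induction_on with
  | _ k ih =>
  intro b hk hb
  by_cases hba : b = a
  · subst hba
    exact ⟨∅, by simp⟩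
  obtain ⟨c, hc, ⟨x, hx, rfl, rfl⟩, hlt⟩ := hrank b hb hba
  obtain ⟨P, hP, hs, ht, hn⟩ := ih _ (hk ▸ hlt) _ rfl hc
  have hxP : x ∉ P := fun hxP => (hP x hxP).2.1.false
  refine ⟨insert x P, ?_, ?_, ?_, ?_⟩
  · intro y hy
    rcases Finset.mem_insert.1 hy with rfl | hy
    · exact ⟨hx, hlt, le_rfl⟩
    · obtain ⟨h1, h2, h3⟩ := hP y hy
      exact ⟨h1, h2.trans hlt, h3.trans hlt.le⟩
  · rw [Finset.coe_insert, Set.injOn_insert (by simpa using hxP)]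
    refine ⟨hs, ?_⟩
    rintro ⟨y, hy, he⟩
    exact absurd (hP y hy).2.1 (by rw [he]; exact lt_irrefl _)
  · rw [Finset.coe_insert, Set.injOn_insert (by simpa using hxP)]
    refine ⟨ht, ?_⟩
    rintro ⟨y, hy, he⟩
    exact absurd (hP y hy).2.2 (by rw [he]; exact hlt.not_ge)
  · intro n
    have h1 := hn n
    have hne : src x ≠ tgt x := fun he => absurd hlt (by rw [he]; exact lt_irrefl _)
    rw [Finset.filter_insert, Finset.filter_insert]
    have e1 : x ∉ P.filter fun y => src y = n := fun h => hxP (Finset.mem_filter.1 h).1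
    have e2 : x ∉ P.filter fun y => tgt y = n := fun h => hxP (Finset.mem_filter.1 h).1
    have e3 : ∀ m : N, (if n = m then (1 : ℤ) else 0) = if m = n then 1 else 0 := fun m => by
      simp only [eq_comm]
    rw [e3, e3] at h1 ⊢
    by_cases g1 : src x = n <;> by_cases g2 : tgt x = n
    · exact absurd (g1.trans g2.symm) hne
    · rw [if_pos g1, if_neg g2, if_neg g2, Finset.card_insert_of_notMem e1]
      rw [if_pos g1] at h1
      push_cast
      linarith
    · rw [if_neg g1, if_pos g2, if_pos g2, Finset.card_insert_of_notMem e2]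
      rw [if_neg g1] at h1
      push_cast
      linarith
    · rw [if_neg g1, if_neg g2, if_neg g2]
      rw [if_neg g1] at h1
      linarith

end Rank

open scoped Classical in
/-- The number of darts leaving a vertex is its degree. -/
lemma card_darts_eq_deg {V E : Type*} [Finite V] [Finite E] {G : Graph V E}
    (v : V) : (Finset.univ.filter fun d : G.Dart => d.fst = v).card = G.deg v := by
  have : G.incidenceSet v =
      ((Finset.univ.filter fun d : G.Dart => d.fst = v).image Dart.edge : Finset E) := by
    ext e
    simp only [Finset.coe_image, Finset.coe_filter, Finset.mem_univ, true_and, Set.mem_image,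
      Set.mem_ofPred_eq]
    constructor
    · rintro ⟨y, hy⟩
      exact ⟨⟨e, v, y, hy⟩, rfl, rfl⟩
    · rintro ⟨d, rfl, rfl⟩
      exact ⟨d.snd, d.isLink⟩
  rw [deg, this, Set.ncard_coe_finset, Finset.card_image_of_injOn]
  rintro ⟨e, u, w, h⟩ hd ⟨e', u', w', h'⟩ hd' he
  simp only [Finset.coe_filter, Finset.mem_univ, true_and, Set.mem_ofPred_eq] at hd hd' he
  subst hd hd' he
  obtain rfl := h.right_unique h'
  rfl

namespace Dart

variable {V E : Type*} {G : Graph V E}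

@[simp] lemma rev_rev (d : G.Dart) : d.rev.rev = d := rfl
@[simp] lemma rev_fst (d : G.Dart) : d.rev.fst = d.snd := rfl
@[simp] lemma rev_snd (d : G.Dart) : d.rev.snd = d.fst := rfl
@[simp] lemma rev_edge (d : G.Dart) : d.rev.edge = d.edge := rfl

lemma rev_injective : Function.Injective (rev : G.Dart → G.Dart) :=
  (revPerm G).injective

lemma rev_ne (hG : G.Loopless) (d : G.Dart) : d.rev ≠ d := by
  intro h
  have h1 : d.snd = d.fst := congrArg fst h
  have h2 := d.isLink
  rw [h1] at h2
  exact hG.not_isLoopAt _ _ h2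

end Dart

namespace RotationSystem

variable {V E : Type*} {G : Graph V E} (M : G.RotationSystem)

lemma face_eq_iff {d d' : G.Dart} : M.face d = M.face d' ↔ M.succ.SameCycle d d' :=
  Quotient.eq (r := Equiv.Perm.SameCycle.setoid M.succ)

lemma succ_rev (d : G.Dart) : M.succ d.rev = M.next d := rfl

lemma succ_fst (d : G.Dart) : (M.succ d).fst = d.snd :=
  ((M.sameCycle_iff _ _).1
    (Equiv.Perm.sameCycle_apply_right.2 .rfl : M.next.SameCycle d.rev _)).symm

@[simp] lemma next_fst (d : G.Dart) : (M.next d).fst = d.fst :=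
  ((M.sameCycle_iff _ _).1 (Equiv.Perm.sameCycle_apply_right.2 .rfl : M.next.SameCycle d _)).symm

lemma face_succ (d : G.Dart) : M.face (M.succ d) = M.face d :=
  M.face_eq_iff.2 (Equiv.Perm.sameCycle_apply_left.2 .rfl)

instance [Finite V] [Finite E] : Finite M.Face :=
  inferInstanceAs (Finite (Quotient _))

end RotationSystem

namespace OrthogonalRepresentation

variable {V E : Type*} [Finite V] [Finite E] {G : Graph V E} {s t : V}
  (R : G.OrthogonalRepresentation s t)

/-! ### The faces of `G + st` -/

/-- The same orthogonal representation with the roles of the poles exchanged. -/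
def swap : G.OrthogonalRepresentation t s :=
  { R with
    sOut := R.tOut
    tOut := R.sOut
    sOut_fst := R.tOut_fst
    tOut_fst := R.sOut_fst
    face_sOut := R.face_tOut
    face_tOut := R.face_sOut }

lemma sOut_ne_tOut (hst : s ≠ t) : R.sOut ≠ R.tOut := fun h =>
  hst (R.sOut_fst.symm.trans ((congrArg Dart.fst h).trans R.tOut_fst))

lemma sameCycle_out : R.succ.SameCycle R.sOut R.tOut :=
  R.face_eq_iff.1 (R.face_sOut.trans R.face_tOut.symm)

open Classical in
/-- The face of `G + st` to the right of a dart: the face of `G`, with a flag that is set on the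
darts of `π(s, t)` only. So the outer face splits into a side along `π(s, t)` and a side along
`π(t, s)`. -/
noncomputable def node (d : G.Dart) : R.Face × Bool :=
  (R.face d, decide (d ∈ arc R.succ R.sOut R.tOut))

/-- The side of the outer face along `π(s, t)`. -/
def outerST : R.Face × Bool := (R.outer, true)

/-- The side of the outer face along `π(t, s)`. -/
def outerTS : R.Face × Bool := (R.outer, false)

lemma outerST_ne_outerTS : R.outerST ≠ R.outerTS := by simp [outerST, outerTS]

variable {R}

lemma node_eq_outerST_iff {d : G.Dart} :
    R.node d = R.outerST ↔ d ∈ arc R.succ R.sOut R.tOut := by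
  simp only [node, outerST, Prod.mk.injEq, decide_eq_true_eq, and_iff_right_iff_imp]
  intro h
  rw [← R.face_sOut, R.face_eq_iff]
  exact (sameCycle_of_mem_arc h).symm

lemma node_eq_outerTS_iff (hst : s ≠ t) {d : G.Dart} :
    R.node d = R.outerTS ↔ d ∈ arc R.succ R.tOut R.sOut := by
  simp only [node, outerTS, Prod.mk.injEq, decide_eq_false_iff_not]
  rw [← R.face_sOut, R.face_eq_iff]
  constructor
  · rintro ⟨h1, h2⟩
    exact (mem_arc_or_mem_arc R.sameCycle_out (R.sOut_ne_tOut hst) h1.symm).resolve_left h2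
  · intro h
    exact ⟨((R.sameCycle_out).trans (sameCycle_of_mem_arc h)).symm,
      fun h' => Finset.disjoint_left.1 (disjoint_arc R.sameCycle_out) h' h⟩

lemma node_of_face_ne {d : G.Dart} (h : R.face d ≠ R.outer) : R.node d = (R.face d, false) := by
  have : d ∉ arc R.succ R.sOut R.tOut := fun h' =>
    h (congrArg Prod.fst (node_eq_outerST_iff.2 h'))
  simp [node, this]

lemma node_of_face_eq {d : G.Dart} (h : R.face d = R.outer) :
    R.node d = R.outerST ∨ R.node d = R.outerTS := by
  by_cases h' : d ∈ arc R.succ R.sOut R.tOut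
  · exact Or.inl (node_eq_outerST_iff.2 h')
  · right
    simp [node, outerTS, h, h']

lemma node_sOut (hst : s ≠ t) : R.node R.sOut = R.outerST :=
  node_eq_outerST_iff.2 (left_mem_arc R.sameCycle_out (R.sOut_ne_tOut hst))

lemma node_tOut (hst : s ≠ t) : R.node R.tOut = R.outerTS :=
  (node_eq_outerTS_iff hst).2 (left_mem_arc R.sameCycle_out.symm (R.sOut_ne_tOut hst).symm)

lemma node_succ (hst : s ≠ t) {d : G.Dart} (h1 : R.succ d ≠ R.sOut) (h2 : R.succ d ≠ R.tOut) :
    R.node (R.succ d) = R.node d := by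
  by_cases h : R.face d = R.outer
  · rcases node_of_face_eq h with h' | h'
    · rw [h', node_eq_outerST_iff]
      exact (apply_mem_arc R.sameCycle_out (node_eq_outerST_iff.1 h')).resolve_left h2
    · rw [h', node_eq_outerTS_iff hst]
      exact (apply_mem_arc R.sameCycle_out.symm ((node_eq_outerTS_iff hst).1 h')).resolve_left h1
  · rw [node_of_face_ne h, node_of_face_ne (by rwa [R.face_succ]), R.face_succ]

lemma node_of_succ_eq_tOut (hst : s ≠ t) {d : G.Dart} (h : R.succ d = R.tOut) :
    R.node d = R.outerST := by
  have hf : R.face d = R.outer := by rw [← R.face_succ, h, R.face_tOut]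
  refine (node_of_face_eq hf).resolve_right fun h' => ?_
  rcases apply_mem_arc R.sameCycle_out.symm ((node_eq_outerTS_iff hst).1 h') with h1 | h1
  · exact R.sOut_ne_tOut hst (h1.symm.trans h)
  · -- The arc from `tOut` to `sOut` enters `tOut` only if `tOut` is hit twice.
    obtain ⟨i, hi, he⟩ := mem_arc.1 ((node_eq_outerTS_iff hst).1 h')
    have h2 : (R.succ ^ (i + 1)) R.tOut = R.tOut := by
      rw [pow_succ', Equiv.Perm.mul_apply, he, h]
    have := hitTime_lt_of_periodic R.sameCycle_out.symm (Nat.succ_pos i) h2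
    omega

lemma node_of_succ_eq_sOut {d : G.Dart} (h : R.succ d = R.sOut) :
    R.node d = R.outerTS := by
  have hf : R.face d = R.outer := by rw [← R.face_succ, h, R.face_sOut]
  refine (node_of_face_eq hf).resolve_left fun h' => ?_
  obtain ⟨i, hi, he⟩ := mem_arc.1 (node_eq_outerST_iff.1 h')
  have h2 : (R.succ ^ (i + 1)) R.sOut = R.sOut := by
    rw [pow_succ', Equiv.Perm.mul_apply, he, h]
  have := hitTime_lt_of_periodic R.sameCycle_out (Nat.succ_pos i) h2
  omega

/-- The faces on both sides of an edge meet, at its initial vertex, in consecutive angles. The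
angles of the poles in the outer face are the only exception. -/
lemma node_rev (hst : s ≠ t) {d : G.Dart} (h1 : R.next d ≠ R.sOut) (h2 : R.next d ≠ R.tOut) :
    R.node d.rev = R.node (R.next d) := by
  rw [← R.succ_rev, node_succ hst] <;> rwa [R.succ_rev]

variable (R)

open Classical in
/-- The rotation at the initial vertex of a dart, except for the angles of the poles in the outer
face, which belong to neither of its sides. -/
noncomputable def freeRot (d : G.Dart) : ℤ :=
  if d = R.sOut ∨ d = R.tOut then 0 else R.vertexRot d

open Classical in
/-- The sum of the rotations in a face of `G + st`, without those at the new edge. -/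
noncomputable def nodeSum (n : R.Face × Bool) : ℤ :=
  ∑ d : G.Dart with R.node d = n, (R.edgeRot d + R.freeRot d)

lemma sum_arc (g : G.Dart → ℤ) {d d' : G.Dart} (h : R.succ.SameCycle d d') :
    ∑ e ∈ arc R.succ d d', g e = ∑ i ∈ Finset.range (R.dist d d'), g ((R.succ ^ i) d) := by
  classical
  rw [arc]
  exact Finset.sum_image (pow_injOn_hitTime h)

lemma sum_arc_eq_pathRot {d d' : G.Dart} (h : R.succ.SameCycle d d') (hne : d ≠ d')
    (hd : R.freeRot d = 0)
    (hd' : ∀ e ∈ arc R.succ d d', e ≠ d → R.freeRot e = R.vertexRot e) :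
    ∑ e ∈ arc R.succ d d', (R.edgeRot e + R.freeRot e) = R.pathRot d d' := by
  rw [sum_arc R _ h, Finset.sum_add_distrib, pathRot]
  congr 1
  have hpos : 0 < R.dist d d' := hitTime_pos h hne
  rw [Finset.range_eq_Ico, Finset.sum_eq_sum_Ico_succ_bot hpos]
  simp only [pow_zero, Equiv.Perm.coe_one, id_eq, hd, zero_add]
  refine Finset.sum_congr rfl fun i hi => ?_
  rw [Finset.mem_Ico] at hi
  refine hd' _ (mem_arc.2 ⟨i, hi.2, rfl⟩) fun he => ?_
  have := hitTime_lt_of_periodic h hi.1 he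
  exact hi.2.not_gt this

lemma nodeSum_outerST (hst : s ≠ t) : R.nodeSum R.outerST = R.rotST := by
  have h := R.sOut_ne_tOut hst
  rw [rotST, ← sum_arc_eq_pathRot R R.sameCycle_out h (by simp [freeRot]), nodeSum]
  · refine Finset.sum_congr ?_ fun _ _ => rfl
    ext d
    simp [node_eq_outerST_iff]
  · intro e he hne
    have : e ≠ R.tOut := fun h' => right_notMem_arc R.sameCycle_out h (h' ▸ he)
    simp [freeRot, hne, this]

lemma nodeSum_outerTS (hst : s ≠ t) : R.nodeSum R.outerTS = R.rotTS := by
  have h := R.sOut_ne_tOut hst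
  rw [rotTS, ← sum_arc_eq_pathRot R R.sameCycle_out.symm h.symm (by simp [freeRot]), nodeSum]
  · refine Finset.sum_congr ?_ fun _ _ => rfl
    ext d
    simp [node_eq_outerTS_iff hst]
  · intro e he hne
    have : e ≠ R.sOut := fun h' => right_notMem_arc R.sameCycle_out.symm h.symm (h' ▸ he)
    simp [freeRot, hne, this]

lemma nodeSum_of_ne {f : R.Face} (hf : f ≠ R.outer) : R.nodeSum (f, false) = 4 := by
  classical
  rw [← if_neg (c := f = R.outer) (t := (-4 : ℤ)) (e := 4) hf, ← R.sum_face f, nodeSum]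
  refine Finset.sum_congr ?_ fun d hd => ?_
  · ext d
    simp only [Finset.mem_filter, Finset.mem_univ, true_and]
    constructor
    · intro h
      exact congrArg Prod.fst h
    · rintro rfl
      exact node_of_face_ne hf
  · rw [Finset.mem_filter] at hd
    have h1 : d ≠ R.sOut := by
      rintro rfl
      exact hf (hd.2 ▸ R.face_sOut)
    have h2 : d ≠ R.tOut := by
      rintro rfl
      exact hf (hd.2 ▸ R.face_tOut)
    simp [freeRot, h1, h2]

lemma sum_freeRot (S : Finset G.Dart) (hst : s ≠ t) (hs : R.sOut ∈ S) (ht : R.tOut ∈ S) :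
    ∑ d ∈ S, R.vertexRot d =
      ∑ d ∈ S, R.freeRot d + R.vertexRot R.sOut + R.vertexRot R.tOut := by
  classical
  have h : ∀ d ∈ S, R.vertexRot d = R.freeRot d +
      ((if d = R.sOut then R.vertexRot R.sOut else 0) +
        if d = R.tOut then R.vertexRot R.tOut else 0) := by
    intro d _
    have := R.sOut_ne_tOut hst
    rw [freeRot]
    by_cases h1 : d = R.sOut <;> by_cases h2 : d = R.tOut
    · exact absurd (h1.symm.trans h2) this
    · simp [h1, this]
    · simp [h2, this.symm]
    · simp [h1, h2]
  rw [Finset.sum_congr rfl h, Finset.sum_add_distrib, Finset.sum_add_distrib,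
    Finset.sum_ite_eq' S, Finset.sum_ite_eq' S, if_pos hs, if_pos ht, add_assoc]

lemma rotST_add_rotTS (hst : s ≠ t) :
    R.rotST + R.rotTS + R.vertexRot R.sOut + R.vertexRot R.tOut = -4 := by
  classical
  have h := R.sum_face R.outer
  rw [if_pos rfl, Finset.sum_add_distrib, R.sum_freeRot _ hst (by simpa using R.face_sOut)
    (by simpa using R.face_tOut)] at h
  rw [← R.nodeSum_outerST hst, ← R.nodeSum_outerTS hst, ← h, nodeSum, nodeSum,
    ← Finset.sum_union, ← add_assoc, ← add_assoc, ← Finset.sum_add_distrib]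
  · congr 3
    ext d
    simp only [Finset.mem_union, Finset.mem_filter, Finset.mem_univ, true_and]
    constructor
    · rintro (h | h) <;> exact congrArg Prod.fst h
    · exact node_of_face_eq
  · rw [Finset.disjoint_filter]
    intro d _ h1 h2
    exact R.outerST_ne_outerTS (h1.symm.trans h2)

end OrthogonalRepresentation

/-! ### Residual arcs and augmenting paths -/

section ResArc

variable {V E : Type*} {G : Graph V E}

/-- An arc moves one unit of rotation between two faces, either across the edge of a dart or between
two angles at a common vertex. -/
abbrev ResArc (G : Graph V E) := G.Dart ⊕ G.Dart × G.Dart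

open Classical in
/-- The change of the rotations of edges along an arc. -/
noncomputable def edgeEffect (x : ResArc G) (d : G.Dart) : ℤ :=
  match x with
  | .inl e => (if d = e then 1 else 0) - if d = e.rev then 1 else 0
  | .inr _ => 0

open Classical in
/-- The change of the rotations of vertices along an arc. -/
noncomputable def vertexEffect (x : ResArc G) (d : G.Dart) : ℤ :=
  match x with
  | .inl _ => 0
  | .inr e => (if d = e.1 then 1 else 0) - if d = e.2 then 1 else 0

lemma edgeEffect_rev (x : ResArc G) (d : G.Dart) : edgeEffect x d + edgeEffect x d.rev = 0 := by
  rcases x with e | e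
  · have h1 : d.rev = e ↔ d = e.rev :=
      ⟨fun h => by rw [← h, Dart.rev_rev], fun h => by rw [h, Dart.rev_rev]⟩
    have h2 : d.rev = e.rev ↔ d = e := Dart.rev_injective.eq_iff
    simp only [edgeEffect]
    split_ifs <;> first | rfl | (exfalso; tauto)
  · simp [edgeEffect]

end ResArc

lemma sum_nonpos_or_le_one {α : Type*} {P : Finset (α)} {g : α → ℤ} {c : α → Prop}
    (hg : ∀ x ∈ P, ¬ c x → g x ≤ 0) (hg' : ∀ x ∈ P, g x ≤ 1)
    (hc : ∀ x ∈ P, ∀ y ∈ P, c x → c y → x = y) :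
    ∑ x ∈ P, g x ≤ 0 ∨ (∃ x ∈ P, c x) ∧ ∑ x ∈ P, g x ≤ 1 := by
  classical
  by_cases h : ∃ x ∈ P, c x
  · right
    refine ⟨h, ?_⟩
    obtain ⟨x, hx, hcx⟩ := h
    rw [← Finset.add_sum_erase P g hx]
    have : ∑ y ∈ P.erase x, g y ≤ 0 := by
      refine Finset.sum_nonpos fun y hy => ?_
      rw [Finset.mem_erase] at hy
      exact hg y hy.2 fun hcy => hy.1 (hc y hy.2 x hx hcy hcx)
    linarith [hg' x hx]
  · left
    push Not at h
    exact Finset.sum_nonpos fun x hx => hg x hx (h x hx)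

namespace OrthogonalRepresentation

variable {V E : Type*} [Finite V] [Finite E] {G : Graph V E} {s t : V}
  (R : G.OrthogonalRepresentation s t)

/-- The face in which the rotation increases. -/
noncomputable def arcSrc : ResArc G → R.Face × Bool
  | .inl d => R.node d
  | .inr x => R.node x.1

/-- The face in which the rotation decreases. -/
noncomputable def arcTgt : ResArc G → R.Face × Bool
  | .inl d => R.node d.rev
  | .inr x => R.node x.2

/-- The arcs along which the rotation may be changed by one: edges that are not bent as far as
their flexibility admits, and consecutive angles at a vertex other than the poles whose rotations
stay in the range from `-2` to `1`. -/
def Usable (flex : E → ℕ) : ResArc G → Prop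
  | .inl d => R.edgeRot d < flex d.edge
  | .inr x => (R.next x.1 = x.2 ∨ R.next x.2 = x.1) ∧ x.1.fst ≠ s ∧ x.1.fst ≠ t ∧
      R.vertexRot x.1 < 1 ∧ -2 < R.vertexRot x.2

/-- There is a usable arc between two faces of `G + st`. -/
def Step (flex : E → ℕ) (m n : R.Face × Bool) : Prop :=
  ∃ x, R.Usable flex x ∧ R.arcSrc x = m ∧ R.arcTgt x = n

variable {R}

lemma fst_eq_of_usable {flex : E → ℕ} {x : G.Dart × G.Dart} (h : R.Usable flex (.inr x)) :
    x.2.fst = x.1.fst := by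
  rcases h.1 with h | h
  · rw [← h, R.next_fst]
  · rw [← h, R.next_fst]

open Classical in
lemma sum_effect (n : R.Face × Bool) (x : ResArc G) :
    ∑ d : G.Dart with R.node d = n, (edgeEffect x d + vertexEffect x d) =
      (if R.arcSrc x = n then 1 else 0) - if R.arcTgt x = n then 1 else 0 := by
  rcases x with e | e <;>
  · simp only [edgeEffect, vertexEffect, arcSrc, arcTgt, add_zero, zero_add,
      Finset.sum_sub_distrib, Finset.sum_ite_eq', Finset.mem_filter, Finset.mem_univ, true_and]
    congr

open Classical in
lemma sum_vertexEffect {flex : E → ℕ} {x : ResArc G} (h : R.Usable flex x) (v : V) :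
    ∑ d : G.Dart with d.fst = v, vertexEffect x d = 0 := by
  rcases x with e | e
  · simp [vertexEffect]
  · simp [vertexEffect, fst_eq_of_usable h]

lemma edgeRot_add_le {flex : E → ℕ} (hR : R.IsValid flex) {P : Finset (ResArc G)}
    (hP : ∀ x ∈ P, R.Usable flex x) (d : G.Dart) :
    R.edgeRot d + ∑ x ∈ P, edgeEffect x d ≤ flex d.edge := by
  classical
  have h1 : ∑ x ∈ P, edgeEffect x d ≤ ∑ x ∈ P, if x = .inl d then 1 else 0 := by
    refine Finset.sum_le_sum fun x _ => ?_
    rcases x with e | e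
    · simp only [edgeEffect, Sum.inl.injEq, eq_comm (a := e)]
      split_ifs <;> simp
    · simp [edgeEffect]
  rw [Finset.sum_ite_eq'] at h1
  have h2 := (abs_le.1 (hR d)).2
  split_ifs at h1 with h
  · have h3 : R.edgeRot d < flex d.edge := hP _ h
    linarith
  · linarith

lemma vertexRot_add_mem {flex : E → ℕ} {P : Finset (ResArc G)}
    (hP : ∀ x ∈ P, R.Usable flex x) (hs : Set.InjOn R.arcSrc P) (ht : Set.InjOn R.arcTgt P)
    (d : G.Dart) : R.vertexRot d + ∑ x ∈ P, vertexEffect x d ∈ Set.Icc (-2) 1 := by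
  have hd := R.vertexRot_mem d
  rw [Set.mem_Icc] at hd ⊢
  constructor
  · have key := sum_nonpos_or_le_one (P := P) (g := fun x => - vertexEffect x d)
      (c := fun x => ∃ e, x = .inr (e, d)) (by
        rintro (e | ⟨e, e'⟩) - hc
        · simp [vertexEffect]
        · have : d ≠ e' := fun he => hc ⟨e, by rw [he]⟩
          simp only [vertexEffect, this, if_false]
          split_ifs <;> simp) (by
        rintro (e | ⟨e, e'⟩) -
        · simp [vertexEffect]
        · simp only [vertexEffect]
          split_ifs <;> simp) (by
        rintro _ hx _ hy ⟨e, rfl⟩ ⟨e', rfl⟩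
        exact ht hx hy rfl)
    rw [Finset.sum_neg_distrib] at key
    rcases key with h | ⟨⟨x, hx, e, rfl⟩, h⟩
    · linarith
    · have h1 : -2 < R.vertexRot d := (hP _ hx).2.2.2.2
      linarith
  · have key := sum_nonpos_or_le_one (P := P) (g := fun x => vertexEffect x d)
      (c := fun x => ∃ e, x = .inr (d, e)) (by
        rintro (e | ⟨e, e'⟩) - hc
        · simp [vertexEffect]
        · have : d ≠ e := fun he => hc ⟨e', by rw [he]⟩
          simp only [vertexEffect, this, if_false]
          split_ifs <;> simp) (by
        rintro (e | ⟨e, e'⟩) -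
        · simp [vertexEffect]
        · simp only [vertexEffect]
          split_ifs <;> simp) (by
        rintro _ hx _ hy ⟨e, rfl⟩ ⟨e', rfl⟩
        exact hs hx hy rfl)
    rcases key with h | ⟨⟨x, hx, e, rfl⟩, h⟩
    · linarith
    · have h1 : R.vertexRot d < 1 := (hP _ hx).2.2.2.1
      linarith

lemma sum_vertexEffect_of_pole {flex : E → ℕ} {P : Finset (ResArc G)}
    (hP : ∀ x ∈ P, R.Usable flex x) {d : G.Dart} (hd : d.fst = s ∨ d.fst = t) :
    ∑ x ∈ P, vertexEffect x d = 0 := by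
  refine Finset.sum_eq_zero fun x hx => ?_
  rcases x with e | e
  · rfl
  · have h := hP _ hx
    have h1 : d ≠ e.1 := by
      rintro rfl
      exact hd.elim h.2.1 h.2.2.1
    have h2 : d ≠ e.2 := by
      rintro rfl
      rw [fst_eq_of_usable h] at hd
      exact hd.elim h.2.1 h.2.2.1
    simp [vertexEffect, h1, h2]

/-- If usable arcs lead from the side of the outer face along `π(s, t)` to the other one, then one
unit of rotation can be moved from `π(t, s)` to `π(s, t)` without changing the embedding. -/
lemma exists_augmentation (hst : s ≠ t) {flex : E → ℕ} (hR : R.IsValid flex)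
    (h : Relation.ReflTransGen (R.Step flex) R.outerST R.outerTS) :
    ∃ R' : G.OrthogonalRepresentation s t, R'.IsValid flex ∧
      R'.vertexRot R'.sOut = R.vertexRot R.sOut ∧ R'.vertexRot R'.tOut = R.vertexRot R.tOut ∧
      R'.rotST = R.rotST + 1 ∧ R'.rotTS = R.rotTS - 1 := by
  classical
  obtain ⟨P, hP, hs, ht, hn⟩ := exists_simple_path R.arcSrc R.arcTgt (R.Usable flex) h
  have hnode : ∀ n, ∑ d : G.Dart with R.node d = n,
      (∑ x ∈ P, edgeEffect x d + ∑ x ∈ P, vertexEffect x d) =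
      (if n = R.outerST then 1 else 0) - if n = R.outerTS then 1 else 0 := by
    intro n
    refine Eq.trans ?_ ((hn n).trans (by congr))
    rw [Finset.sum_congr rfl fun d _ => (Finset.sum_add_distrib ..).symm,
      Finset.sum_comm, Finset.sum_congr rfl fun x _ => sum_effect n x, Finset.sum_sub_distrib,
      Finset.sum_boole, Finset.sum_boole]
    congr
  have hsP : ∑ x ∈ P, vertexEffect x R.sOut = 0 :=
    sum_vertexEffect_of_pole hP (Or.inl R.sOut_fst)
  have htP : ∑ x ∈ P, vertexEffect x R.tOut = 0 :=
    sum_vertexEffect_of_pole hP (Or.inr R.tOut_fst)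
  have hrev : ∀ d : G.Dart, ∑ x ∈ P, edgeEffect x d + ∑ x ∈ P, edgeEffect x d.rev = 0 := by
    intro d
    rw [← Finset.sum_add_distrib]
    exact Finset.sum_eq_zero fun x _ => edgeEffect_rev x d
  let R' : G.OrthogonalRepresentation s t :=
    { R with
      edgeRot := fun d => R.edgeRot d + ∑ x ∈ P, edgeEffect x d
      vertexRot := fun d => R.vertexRot d + ∑ x ∈ P, vertexEffect x d
      sum_face := by
        intro f
        rw [← R.sum_face f, ← sub_eq_zero, ← Finset.sum_sub_distrib]
        have h1 : (Finset.univ.filter fun d : G.Dart => R.face d = f) =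
            (Finset.univ.filter fun d => R.node d = (f, true)) ∪
              Finset.univ.filter fun d => R.node d = (f, false) := by
          ext d
          simp only [node, Finset.mem_filter, Finset.mem_univ, true_and, Finset.mem_union,
            Prod.mk.injEq]
          cases decide (d ∈ arc R.succ R.sOut R.tOut) <;> simp
        have h2 : Disjoint (Finset.univ.filter fun d => R.node d = (f, true))
            (Finset.univ.filter fun d => R.node d = (f, false)) := by
          rw [Finset.disjoint_filter]
          intro d _ h1 h2
          simpa using h1.symm.trans h2
        have h3 := hnode (f, true)
        have h4 := hnode (f, false)
        simp only [outerST, outerTS, Prod.mk.injEq, and_true, and_false, if_false,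
          Bool.true_eq_false, Bool.false_eq_true] at h3 h4
        rw [h1, Finset.sum_union h2]
        simp only [add_sub_add_comm, add_sub_cancel_left]
        rw [h3, h4]
        ring
      edgeRot_rev := fun d => by linarith [R.edgeRot_rev d, hrev d]
      sum_vertex := by
        intro v hv
        rw [Finset.sum_add_distrib, R.sum_vertex v hv, Finset.sum_comm,
          Finset.sum_eq_zero fun x hx => sum_vertexEffect (hP x hx) v, add_zero]
      vertexRot_mem := vertexRot_add_mem hP hs ht }
  have hR' : ∀ n, R'.nodeSum n = R.nodeSum n +
      ((if n = R.outerST then 1 else 0) - if n = R.outerTS then 1 else 0) := by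
    intro n
    rw [← hnode n]
    simp only [nodeSum]
    rw [← Finset.sum_add_distrib]
    refine Finset.sum_congr rfl fun d _ => ?_
    have h1 : R'.freeRot d = R.freeRot d + ∑ x ∈ P, vertexEffect x d := by
      change (if d = R.sOut ∨ d = R.tOut then 0 else
        R.vertexRot d + ∑ x ∈ P, vertexEffect x d) = _
      rw [freeRot]
      split_ifs with hd
      · rcases hd with rfl | rfl
        · rw [hsP, add_zero]
        · rw [htP, add_zero]
      · rfl
    have h2 : R'.edgeRot d = R.edgeRot d + ∑ x ∈ P, edgeEffect x d := rfl
    rw [h1, h2]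
    ring
  refine ⟨R', ?_, ?_, ?_, ?_, ?_⟩
  · intro d
    rw [abs_le]
    refine ⟨?_, edgeRot_add_le hR hP d⟩
    have h1 := edgeRot_add_le hR hP d.rev
    rw [Dart.rev_edge] at h1
    change _ ≤ R.edgeRot d + ∑ x ∈ P, edgeEffect x d
    linarith [R.edgeRot_rev d, hrev d]
  · change R.vertexRot R.sOut + _ = _
    rw [hsP, add_zero]
  · change R.vertexRot R.tOut + _ = _
    rw [htP, add_zero]
  · rw [← R'.nodeSum_outerST hst, ← R.nodeSum_outerST hst]
    change R'.nodeSum R.outerST = _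
    rw [hR', if_pos rfl, if_neg R.outerST_ne_outerTS, sub_zero]
  · rw [← R'.nodeSum_outerTS hst, ← R.nodeSum_outerTS hst]
    change R'.nodeSum R.outerTS = _
    rw [hR', if_pos rfl, if_neg R.outerST_ne_outerTS.symm, zero_sub, sub_eq_add_neg]

end OrthogonalRepresentation

lemma RotationSystem.next_induction {V E : Type*} [Finite V] [Finite E] {G : Graph V E}
    (M : G.RotationSystem) {p : G.Dart → Prop} {d : G.Dart}
    (hp : ∀ e : G.Dart, e.fst = d.fst → p e → p (M.next e)) (hd : p d) {d' : G.Dart}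
    (h : d'.fst = d.fst) : p d' := by
  obtain ⟨n, rfl⟩ := ((M.sameCycle_iff d d').2 h.symm).exists_nat_pow_eq
  clear h
  suffices H : ((M.next ^ n) d).fst = d.fst ∧ p ((M.next ^ n) d) from H.2
  induction n with
  | zero => exact ⟨rfl, hd⟩
  | succ n ih =>
    rw [pow_succ', Equiv.Perm.mul_apply]
    exact ⟨(M.next_fst _).trans ih.1, hp _ ih.1 ih.2⟩

/-- Adjacency in the graph without the darts in `T`. -/
def Avoids {V E : Type*} {G : Graph V E} (T : Finset G.Dart) (x y : V) : Prop :=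
  ∃ e : G.Dart, e ∉ T ∧ e.fst = x ∧ e.snd = y

lemma Avoids.symm {V E : Type*} {G : Graph V E} {T : Finset G.Dart} (hT : ∀ d ∈ T, d.rev ∈ T)
    {x y : V} (h : Avoids T x y) : Avoids T y x := by
  obtain ⟨e, he, rfl, rfl⟩ := h
  exact ⟨e.rev, fun h => he (hT _ h), rfl, rfl⟩

namespace OrthogonalRepresentation

variable {V E : Type*} [Finite V] [Finite E] {G : Graph V E} {s t : V}
  (R : G.OrthogonalRepresentation s t)

/-! ### The set of reachable faces -/

/-- The faces of `G + st` that can be reached from the side of the outer face along `π(s, t)`. -/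
def reach (flex : E → ℕ) : Set (R.Face × Bool) :=
  {n | Relation.ReflTransGen (R.Step flex) R.outerST n}

/-- The face to the right of the dart is reachable. -/
def Inside (flex : E → ℕ) (d : G.Dart) : Prop := R.node d ∈ R.reach flex

variable {R} {flex : E → ℕ}

lemma outerST_mem_reach : R.outerST ∈ R.reach flex := Relation.ReflTransGen.refl

lemma inside_sOut (hst : s ≠ t) : R.Inside flex R.sOut := by
  rw [Inside, node_sOut hst]
  exact outerST_mem_reach

lemma not_inside_tOut (hst : s ≠ t) (hTS : R.outerTS ∉ R.reach flex) :
    ¬ R.Inside flex R.tOut := by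
  rwa [Inside, node_tOut hst]

lemma next_ne_of_fst_ne {d : G.Dart} (hs : d.fst ≠ s) (ht : d.fst ≠ t) :
    R.next d ≠ R.sOut ∧ R.next d ≠ R.tOut := by
  constructor <;> intro h
  · exact hs (by rw [← R.next_fst, h, R.sOut_fst])
  · exact ht (by rw [← R.next_fst, h, R.tOut_fst])

lemma inside_rev_iff (hst : s ≠ t) {d : G.Dart} (hs : d.fst ≠ s) (ht : d.fst ≠ t) :
    R.Inside flex d.rev ↔ R.Inside flex (R.next d) := by
  obtain ⟨h1, h2⟩ := R.next_ne_of_fst_ne hs ht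
  rw [Inside, Inside, node_rev hst h1 h2]

/-- Consecutive angles at a vertex are separated by an edge. So the faces that a usable arc joins
are the two sides of some edge. -/
lemma Step.exists_dart (hst : s ≠ t) {m n : R.Face × Bool} (h : R.Step flex m n) :
    ∃ d : G.Dart, R.node d = m ∧ R.node d.rev = n := by
  obtain ⟨e | ⟨e, e'⟩, hx, rfl, rfl⟩ := h
  · exact ⟨e, rfl, rfl⟩
  · have hfst := fst_eq_of_usable hx
    obtain ⟨h | h, hs, ht, -⟩ := hx
    · obtain ⟨h1, h2⟩ := R.next_ne_of_fst_ne hs ht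
      refine ⟨e, rfl, ?_⟩
      rw [node_rev hst h1 h2]
      exact congrArg R.node h
    · obtain ⟨h1, h2⟩ := R.next_ne_of_fst_ne (d := e') (by rwa [hfst]) (by rwa [hfst])
      refine ⟨e'.rev, ?_, rfl⟩
      rw [node_rev hst h1 h2]
      exact congrArg R.node h

/-- The edges between reachable and unreachable faces are bent as far as possible. -/
lemma edgeRot_eq_flex (hR : R.IsValid flex) {d : G.Dart} (h : R.Inside flex d)
    (h' : ¬ R.Inside flex d.rev) : R.edgeRot d = flex d.edge := by
  refine le_antisymm (abs_le.1 (hR d)).2 (not_lt.1 fun hlt => h' ?_)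
  exact Relation.ReflTransGen.tail h ⟨.inl d, hlt, rfl, rfl⟩

/-! ### Angles at a vertex -/

open Classical in
lemma sum_vertexRot (d : G.Dart) :
    ∑ e : G.Dart with e.fst = d.fst, R.vertexRot e =
      2 * ((Finset.univ.filter fun e : G.Dart => e.fst = d.fst).card : ℤ) - 4 := by
  rw [card_darts_eq_deg, R.sum_vertex _ d.isLink.left_mem]

lemma vertexRot_le (d : G.Dart) : R.vertexRot d ≤ 1 := (R.vertexRot_mem d).2

open Classical in
lemma sum_vertexRot_le (S : Finset G.Dart) : ∑ e ∈ S, R.vertexRot e ≤ S.card := by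
  have := Finset.sum_le_card_nsmul S R.vertexRot 1 fun e _ => R.vertexRot_le e
  simpa using this

open Classical in
/-- In an orthogonal representation the maximum degree is at most `4`. -/
lemma card_darts_le_four (R : G.OrthogonalRepresentation s t) (d : G.Dart) :
    (Finset.univ.filter fun e : G.Dart => e.fst = d.fst).card ≤ 4 := by
  have h := R.sum_vertexRot d
  have := R.sum_vertexRot_le (Finset.univ.filter fun e : G.Dart => e.fst = d.fst)
  omega

/-- A vertex with an angle of rotation less than `1` has degree at most `3`, so all its angles are
consecutive, and a unit of rotation can be moved to this angle from any other one. Hence all the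
reachable angles at a vertex that has an unreachable angle have rotation `1`. -/
lemma vertexRot_eq_one {d d' : G.Dart} (hs : d.fst ≠ s) (ht : d.fst ≠ t)
    (hdd : d'.fst = d.fst) (h : R.Inside flex d) (h' : ¬ R.Inside flex d') :
    R.vertexRot d = 1 := by
  classical
  refine le_antisymm (R.vertexRot_le d) (not_lt.1 fun hlt => h' ?_)
  have hne : d ≠ d' := by
    rintro rfl
    exact h' h
  set S := Finset.univ.filter fun e : G.Dart => e.fst = d.fst with hS
  have hdS : d ∈ S := by simp [hS]
  have hdS' : d' ∈ S.erase d := by simp [hS, hdd, hne.symm]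
  have hsum := R.sum_vertexRot d
  rw [← hS, ← Finset.add_sum_erase S _ hdS, ← Finset.add_sum_erase _ _ hdS'] at hsum
  have hle := R.sum_vertexRot_le ((S.erase d).erase d')
  rw [Finset.card_erase_of_mem hdS', Finset.card_erase_of_mem hdS] at hle
  have hcard : 2 ≤ S.card := by
    have := Finset.card_pos.2 ⟨d', hdS'⟩
    rw [Finset.card_erase_of_mem hdS] at this
    omega
  have h1 := R.vertexRot_le d'
  have hcard3 : S.card ≤ 3 := by omega
  have hd' : -2 < R.vertexRot d' := by omega
  refine Relation.ReflTransGen.tail h ⟨.inr (d, d'), ⟨?_, hs, ht, hlt, hd'⟩, rfl, rfl⟩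
  -- Otherwise the two darts and their successors are four different darts at the vertex.
  by_contra! hcon
  obtain ⟨hn, hn'⟩ := hcon
  have hnd : R.next d ≠ d := fun he =>
    hne (R.next_induction (d := d) (p := fun e => e = d)
      (fun e _ h => by rw [h, he]) rfl hdd).symm
  have hnd' : R.next d' ≠ d' := fun he =>
    hne (R.next_induction (d := d') (p := fun e => e = d')
      (fun e _ h => by rw [h, he]) rfl hdd.symm)
  have hsub : ({d, d', R.next d, R.next d'} : Finset G.Dart) ⊆ S := by
    intro e he
    simp only [Finset.mem_insert, Finset.mem_singleton] at he
    simp only [hS, Finset.mem_filter, Finset.mem_univ, true_and]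
    rcases he with rfl | rfl | rfl | rfl
    · rfl
    · exact hdd
    · exact R.next_fst d
    · exact (R.next_fst d').trans hdd
  have hnn : R.next d ≠ R.next d' := fun he => hne (R.next.injective he)
  have h4 := Finset.card_le_card hsub
  rw [Finset.card_insert_of_notMem, Finset.card_insert_of_notMem, Finset.card_insert_of_notMem,
    Finset.card_singleton] at h4
  · omega
  · simpa using hnn
  · simpa using ⟨hn.symm, hnd'.symm⟩
  · simpa using ⟨hne, hnd.symm, hn'.symm⟩

/-- Around a vertex other than the poles, some edge separates a reachable angle from an
unreachable one, in either order, unless all or no angles are reachable. -/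
lemma exists_boundary (hst : s ≠ t) {d d' : G.Dart} (hs : d.fst ≠ s) (ht : d.fst ≠ t)
    (hdd : d'.fst = d.fst) (h : R.Inside flex d) (h' : ¬ R.Inside flex d') :
    (∃ e : G.Dart, e.fst = d.fst ∧ R.Inside flex e ∧ ¬ R.Inside flex e.rev) ∧
      ∃ e : G.Dart, e.fst = d.fst ∧ R.Inside flex e.rev ∧ ¬ R.Inside flex e := by
  constructor
  · by_contra! hcon
    refine h' (R.next_induction (fun e he hi => ?_) h hdd)
    rw [← inside_rev_iff hst (by rwa [he]) (by rwa [he])]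
    exact hcon e he hi
  · by_contra! hcon
    refine R.next_induction (p := fun e => ¬ R.Inside flex e) (fun e he hi => ?_) h' hdd.symm h
    rw [← inside_rev_iff hst (by rwa [he, hdd]) (by rwa [he, hdd])]
    exact fun h1 => hi (hcon e (he.trans hdd) h1)

/-- The boundary of the set of reachable faces contains an edge that leaves `s`. -/
lemma exists_boundary_left (hst : s ≠ t) (hTS : R.outerTS ∉ R.reach flex) :
    ∃ e : G.Dart, e.fst = s ∧ R.Inside flex e ∧ ¬ R.Inside flex e.rev := by
  by_contra! hcon
  have hall : ∀ e : G.Dart, e.fst = s → R.Inside flex e := by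
    intro e he
    refine R.next_induction (fun e he hi => ?_) (inside_sOut hst) (he.trans R.sOut_fst.symm)
    rw [R.sOut_fst] at he
    by_cases h1 : R.next e = R.sOut
    · rw [h1]
      exact inside_sOut hst
    · have h2 : R.next e ≠ R.tOut := fun h2 => hst (by
        rw [← he, ← R.next_fst, h2, R.tOut_fst])
      have := hcon e he hi
      rwa [Inside, node_rev hst h1 h2] at this
  have hf : (R.next.symm R.sOut).fst = s := by
    rw [← R.next_fst, Equiv.apply_symm_apply, R.sOut_fst]
  have h1 := hcon _ hf (hall _ hf)
  rw [Inside, node_of_succ_eq_sOut (by rw [R.succ_rev, Equiv.apply_symm_apply])] at h1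
  exact hTS h1

/-- The boundary of the set of reachable faces contains an edge that enters `t`. -/
lemma exists_boundary_right (hst : s ≠ t) (hTS : R.outerTS ∉ R.reach flex) :
    ∃ e : G.Dart, e.fst = t ∧ R.Inside flex e.rev ∧ ¬ R.Inside flex e := by
  by_contra! hcon
  have hall : ∀ e : G.Dart, e.fst = t → ¬ R.Inside flex e := by
    intro e he
    refine R.next_induction (p := fun e => ¬ R.Inside flex e) (fun e he hi => ?_)
      (not_inside_tOut hst hTS) (he.trans R.tOut_fst.symm)
    rw [R.tOut_fst] at he
    by_cases h1 : R.next e = R.tOut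
    · rw [h1]
      exact not_inside_tOut hst hTS
    · have h2 : R.next e ≠ R.sOut := fun h2 => hst (by
        rw [← he, ← R.next_fst, h2, R.sOut_fst])
      have h3 : ¬ R.Inside flex e.rev := fun h3 => hi (hcon e he h3)
      rwa [Inside, node_rev hst h2 h1] at h3
  have hf : (R.next.symm R.tOut).fst = t := by
    rw [← R.next_fst, Equiv.apply_symm_apply, R.tOut_fst]
  refine hall _ hf (hcon _ hf ?_)
  rw [Inside, node_of_succ_eq_tOut hst (by rw [R.succ_rev, Equiv.apply_symm_apply])]
  exact outerST_mem_reach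

/-! ### A spanning tree of the reachable faces -/

lemma node_mem_of_mem_reach (hst : s ≠ t) (hTS : R.outerTS ∉ R.reach flex) {n : R.Face × Bool}
    (hn : n ∈ R.reach flex) (hne : n ≠ R.outerST) : n.1 ≠ R.outer ∧ n.2 = false := by
  have : ∃ d, R.node d = n := by
    rcases Relation.ReflTransGen.cases_tail hn with h | ⟨m, -, h⟩
    · exact absurd h hne
    · obtain ⟨d, -, hd⟩ := h.exists_dart hst
      exact ⟨_, hd⟩
  obtain ⟨d, rfl⟩ := this
  have h : R.face d ≠ R.outer := by
    intro h
    rcases node_of_face_eq h with h | h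
    · exact hne h
    · rw [h] at hn
      exact hTS hn
  exact ⟨h, by rw [node_of_face_ne h]⟩

open Classical in
/-- The dual tree `T` on the faces `Y` is extended across the edge of `e` to an inner face outside
of `Y`. The rest of the boundary of the new face contains no edge of the extended tree, and it still
joins the ends of `e`. -/
lemma exists_detour {T : Finset G.Dart} {Y : Finset (R.Face × Bool)} {e : G.Dart}
    (hT : ∀ d ∈ T, R.node d ∈ Y) (hf : R.face e ≠ R.outer) (he : R.node e ∉ Y)
    (he' : R.node e.rev ∈ Y) :
    Relation.ReflTransGen (Avoids (insert e (insert e.rev T))) e.snd e.fst := by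
  obtain ⟨n, hn, hlt⟩ := exists_pow_apply_eq_self (f := R.succ) e
  have hface : ∀ i : ℕ, R.face ((R.succ ^ i) (R.succ e)) = R.face e := fun i =>
    R.face_eq_iff.2 (Equiv.Perm.sameCycle_pow_left.2 (Equiv.Perm.sameCycle_apply_left.2 .rfl))
  suffices H : ∀ i ≤ n, Relation.ReflTransGen (Avoids (insert e (insert e.rev T))) e.snd
      ((R.succ ^ i) (R.succ e)).fst by
    have := H n le_rfl
    rwa [hn] at this
  intro i
  induction i with
  | zero =>
    intro _
    rw [pow_zero, Equiv.Perm.one_apply, R.succ_fst]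
  | succ i ih =>
    intro hi
    refine (ih (by omega)).tail ⟨(R.succ ^ i) (R.succ e), ?_, rfl, ?_⟩
    · have hnode : R.node ((R.succ ^ i) (R.succ e)) = R.node e := by
        rw [node_of_face_ne hf, node_of_face_ne (by rwa [hface]), hface]
      intro hmem
      rw [Finset.mem_insert, Finset.mem_insert] at hmem
      rcases hmem with h | h | h
      · exact hlt i (by omega) h
      · exact he (by rwa [← hnode, h])
      · exact he (by rw [← hnode]; exact hT _ h)
    · rw [pow_succ', Equiv.Perm.mul_apply, R.succ_fst]

/-- The reachable faces are connected by a tree in the dual graph whose edges can be deleted from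
the graph without losing connectedness. The tree is given by the set `T` of its darts. -/
lemma exists_dual_tree (hG : G.Loopless) (hst : s ≠ t) (hTS : R.outerTS ∉ R.reach flex) :
    ∃ T : Finset G.Dart, (∀ d ∈ T, d.rev ∈ T) ∧ (∀ d ∈ T, R.Inside flex d) ∧
      T.card + 2 = 2 * (R.reach flex).ncard ∧
      ∀ d : G.Dart, Relation.ReflTransGen (Avoids T) d.fst d.snd := by
  classical
  have hfin : (R.reach flex).Finite := Set.toFinite _
  let Q : Finset (R.Face × Bool) → Prop := fun Y => R.outerST ∈ Y ∧ (Y : Set _) ⊆ R.reach flex ∧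
    ∃ T : Finset G.Dart, (∀ d ∈ T, d.rev ∈ T) ∧ (∀ d ∈ T, R.node d ∈ Y) ∧
      T.card + 2 = 2 * Y.card ∧ ∀ d : G.Dart, Relation.ReflTransGen (Avoids T) d.fst d.snd
  have hQ : Q {R.outerST} := by
    refine ⟨by simp, ?_, ∅, by simp, by simp, by simp, fun d => ?_⟩
    · rw [Finset.coe_singleton, Set.singleton_subset_iff]
      exact outerST_mem_reach
    · exact .single ⟨d, by simp, rfl, rfl⟩
  obtain ⟨Y, -, hY⟩ := Set.Finite.exists_le_maximal (s := {Y | Q Y})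
    ((hfin.finite_subsets.preimage (Finset.coe_injective.injOn)).subset fun Y hY => hY.2.1) hQ
  obtain ⟨hST, hsub, T, hT1, hT2, hT3, hT4⟩ := hY.prop
  suffices hYX : (Y : Set _) = R.reach flex by
    refine ⟨T, hT1, fun d hd => hsub (hT2 d hd), ?_, hT4⟩
    rw [← hYX, Set.ncard_coe_finset, hT3]
  by_contra hne
  obtain ⟨n, hn, hnY⟩ := Set.exists_of_ssubset (hsub.ssubset_of_ne hne)
  obtain ⟨m, m', hm, hm', hmr, hstep⟩ : ∃ m m', m ∈ Y ∧ m' ∉ Y ∧ m' ∈ R.reach flex ∧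
      R.Step flex m m' := by
    have hn' : Relation.ReflTransGen (R.Step flex) R.outerST n := hn
    clear hn
    induction hn' with
    | refl => exact absurd hST hnY
    | @tail b c hb hbc ih =>
      by_cases hbY : b ∈ Y
      · exact ⟨b, c, hbY, hnY, hb.tail hbc, hbc⟩
      · exact ih hbY
  obtain ⟨d, rfl, rfl⟩ := hstep.exists_dart hst
  have hf : R.face d.rev ≠ R.outer :=
    (node_mem_of_mem_reach hst hTS hmr fun h => hm' (h ▸ hST)).1
  have hdet := exists_detour hT2 hf hm' hm
  set T' := insert d.rev (insert d.rev.rev T) with hT'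
  have hT'1 : ∀ d' ∈ T', d'.rev ∈ T' := by
    intro d' hd'
    rw [hT', Finset.mem_insert, Finset.mem_insert] at hd' ⊢
    rcases hd' with rfl | rfl | h
    · exact Or.inr (Or.inl rfl)
    · exact Or.inl rfl
    · exact Or.inr (Or.inr (hT1 _ h))
  refine hm' (hY.le_of_ge (y := insert (R.node d.rev) Y) ⟨?_, ?_, T', hT'1, ?_, ?_, ?_⟩
    (Finset.subset_insert _ _) (Finset.mem_insert_self _ _))
  · exact Finset.mem_insert_of_mem hST
  · rw [Finset.coe_insert]
    exact Set.insert_subset hmr hsub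
  · intro d' hd'
    rw [hT', Finset.mem_insert, Finset.mem_insert] at hd'
    rcases hd' with rfl | rfl | h
    · exact Finset.mem_insert_self _ _
    · exact Finset.mem_insert_of_mem hm
    · exact Finset.mem_insert_of_mem (hT2 _ h)
  · have hdT : d.rev ∉ T := fun h => hm' (hT2 _ h)
    have hdT' : d.rev.rev ∉ T := fun h => hdT (hT1 _ h)
    rw [hT', Finset.card_insert_of_notMem, Finset.card_insert_of_notMem hdT',
      Finset.card_insert_of_notMem hm']
    · omega
    · rw [Finset.mem_insert, not_or]
      exact ⟨(Dart.rev_ne hG d.rev).symm, hdT⟩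
  · have hstep : ∀ x y, Avoids T x y → Relation.ReflTransGen (Avoids T') x y := by
      rintro x y ⟨e, he, rfl, rfl⟩
      by_cases h1 : e = d.rev
      · rw [h1]
        have : Std.Symm (Avoids T') := ⟨fun _ _ h => h.symm hT'1⟩
        exact Relation.ReflTransGen.stdSymm.symm _ _ hdet
      · by_cases h2 : e = d
        · rw [h2]
          exact hdet
        · refine .single ⟨e, ?_, rfl, rfl⟩
          rw [hT', Finset.mem_insert, Finset.mem_insert]
          tauto
    intro e
    have := hT4 e
    generalize e.snd = y at this ⊢
    induction this with
    | refl => exact .refl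
    | tail _ h ih => exact ih.trans (hstep _ _ h)

end OrthogonalRepresentation

namespace OrthogonalRepresentation

open scoped Classical

variable {V E : Type*} [Finite V] [Finite E] {G : Graph V E} {s t : V}
  (R : G.OrthogonalRepresentation s t)

/-! ### Counting when the two sides of the outer face are separated -/

/-- The darts with a reachable face to their right. -/
noncomputable def insideDarts (flex : E → ℕ) : Finset G.Dart :=
  Finset.univ.filter fun d => R.Inside flex d

/-- The darts with a reachable face to their right and an unreachable one to their left. -/
noncomputable def boundary (flex : E → ℕ) : Finset G.Dart :=
  Finset.univ.filter fun d => R.Inside flex d ∧ ¬ R.Inside flex d.rev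

/-- The darts with reachable faces on both sides. -/
noncomputable def interiorDarts (flex : E → ℕ) : Finset G.Dart :=
  Finset.univ.filter fun d => R.Inside flex d ∧ R.Inside flex d.rev

/-- The vertices other than the poles all of whose angles are reachable. -/
noncomputable def fullVerts (flex : E → ℕ) : Finset V :=
  (Finset.univ.filter fun d : G.Dart => d.fst ≠ s ∧ d.fst ≠ t ∧
    ∀ e : G.Dart, e.fst = d.fst → R.Inside flex e).image Dart.fst

/-- The edges on the boundary of the reachable faces that can compensate for a sharp turn at one of
their ends: an edge of positive flexibility is bent, and a critical edge is paid for. -/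
def Compensates (G : Graph V E) (s t : V) (flex : E → ℕ) (e : E) : Prop :=
  flex e ≠ 0 ∨ G.IsCritical s t flex e

variable {R} {flex : E → ℕ}

/-- The set of reachable faces, without its boundary, has Euler characteristic at most `1`. The
interior edges are counted twice here. Every full vertex is charged to the first edge of a path to
`s` that avoids the edges of the dual tree. -/
lemma card_fullVerts_le (hG : G.Loopless) (hs : s ∈ G.vertexSet) (hst : s ≠ t)
    (hTS : R.outerTS ∉ R.reach flex) :
    2 * (R.fullVerts flex).card + 2 * (R.reach flex).ncard ≤
      (R.interiorDarts flex).card + 2 := by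
  obtain ⟨T, hT1, hT2, hT3, hT4⟩ := R.exists_dual_tree hG hst hTS
  obtain ⟨rank, hrank⟩ := exists_rank (Avoids T) s
  have hreach : ∀ v ∈ G.vertexSet, Relation.ReflTransGen (Avoids T) s v := by
    intro v hv
    have h := R.connected.2 s hs v hv
    clear hv
    induction h with
    | refl => exact .refl
    | tail _ h ih =>
      obtain ⟨e, he⟩ := h
      exact ih.trans (hT4 ⟨e, _, _, he⟩)
  have hfull : ∀ v ∈ R.fullVerts flex, v ≠ s ∧ v ≠ t ∧ v ∈ G.vertexSet ∧
      ∀ e : G.Dart, e.fst = v → R.Inside flex e := by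
    intro v hv
    simp only [fullVerts, Finset.mem_image, Finset.mem_filter, Finset.mem_univ, true_and] at hv
    obtain ⟨d, ⟨h1, h2, h3⟩, rfl⟩ := hv
    exact ⟨h1, h2, d.isLink.left_mem, h3⟩
  have hpar : ∀ v ∈ R.fullVerts flex, ∃ d : G.Dart, d ∉ T ∧ d.snd = v ∧
      rank d.fst < rank d.snd := by
    intro v hv
    obtain ⟨h1, -, h3, -⟩ := hfull v hv
    obtain ⟨c, -, ⟨d, hd, rfl, rfl⟩, hlt⟩ := hrank v (hreach v h3) h1
    exact ⟨d, hd, rfl, hlt⟩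
  have : Nonempty G.Dart := ⟨R.sOut⟩
  choose! p hp1 hp2 hp3 using hpar
  set A := (R.fullVerts flex).image p with hA
  have hAcard : A.card = (R.fullVerts flex).card := by
    refine Finset.card_image_of_injOn fun v hv w hw h => ?_
    rw [← hp2 v hv, ← hp2 w hw, h]
  have hAmem : ∀ d ∈ A, d ∉ T ∧ rank d.fst < rank d.snd ∧ d.snd ∈ R.fullVerts flex := by
    intro d hd
    obtain ⟨v, hv, rfl⟩ := Finset.mem_image.1 hd
    exact ⟨hp1 v hv, hp3 v hv, by rwa [hp2 v hv]⟩
  set A' := A.image Dart.rev with hA'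
  have hA'card : A'.card = A.card := Finset.card_image_of_injective _ Dart.rev_injective
  have hA'mem : ∀ d, d ∈ A' → d.rev ∈ A := by
    intro d hd
    obtain ⟨e, he, rfl⟩ := Finset.mem_image.1 hd
    exact he
  have hAA' : Disjoint A A' := by
    rw [Finset.disjoint_left]
    intro d hd hd'
    have h1 := (hAmem d hd).2.1
    have h2 := (hAmem _ (hA'mem d hd')).2.1
    exact h1.not_gt h2
  have hAT : Disjoint (A ∪ A') T := by
    rw [Finset.disjoint_left]
    intro d hd hdT
    rcases Finset.mem_union.1 hd with h | h
    · exact (hAmem d h).1 hdT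
    · exact (hAmem _ (hA'mem d h)).1 (hT1 d hdT)
  have hrevIn : ∀ d ∈ A, R.Inside flex d ∧ R.Inside flex d.rev := by
    intro d hd
    obtain ⟨h1, h2, -, h4⟩ := hfull _ (hAmem d hd).2.2
    refine ⟨?_, h4 d.rev rfl⟩
    have h := inside_rev_iff (R := R) (flex := flex) hst (d := d.rev) h1 h2
    rw [Dart.rev_rev] at h
    exact h.2 (h4 _ (R.next_fst _))
  have hsub : A ∪ A' ∪ T ⊆ R.interiorDarts flex := by
    intro d hd
    rw [interiorDarts, Finset.mem_filter]
    refine ⟨Finset.mem_univ _, ?_⟩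
    rcases Finset.mem_union.1 hd with h | h
    · rcases Finset.mem_union.1 h with h | h
      · exact hrevIn d h
      · exact (hrevIn _ (hA'mem d h)).symm
    · exact ⟨hT2 d h, hT2 _ (hT1 d h)⟩
  have hcard := Finset.card_le_card hsub
  rw [Finset.card_union_of_disjoint hAT, Finset.card_union_of_disjoint hAA', hA'card,
    hAcard] at hcard
  omega

/-- At a vertex other than the poles, three reachable angles of rotation `1` form a sharp turn.
It occurs only at a vertex of degree `4`, where all inflexible edges are critical. -/
lemma vertex_bound (hst : s ≠ t) {h : G.Dart → V} (hh : h = Dart.fst ∨ h = Dart.snd) {v : V}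
    (hs : v ≠ s) (ht : v ≠ t) :
    2 * (((R.insideDarts flex).filter fun d => d.fst = v).card : ℤ) ≤
      ∑ d ∈ R.insideDarts flex with d.fst = v, R.vertexRot d +
      4 * (if v ∈ R.fullVerts flex then 1 else 0) +
      2 * ((R.boundary flex).filter fun d => h d = v).card +
      ((R.boundary flex).filter fun d => h d = v ∧ Compensates G s t flex d.edge).card := by
  set I := (R.insideDarts flex).filter fun d => d.fst = v with hI
  have hImem : ∀ d, d ∈ I ↔ R.Inside flex d ∧ d.fst = v := fun d => by simp [hI, insideDarts]
  rcases I.eq_empty_or_nonempty with h0 | ⟨d, hd⟩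
  · rw [h0, Finset.card_empty, Finset.sum_empty]
    positivity
  rw [hImem] at hd
  obtain ⟨hd, rfl⟩ := hd
  set S := Finset.univ.filter fun e : G.Dart => e.fst = d.fst with hS
  by_cases hall : ∀ e : G.Dart, e.fst = d.fst → R.Inside flex e
  · have h1 : d.fst ∈ R.fullVerts flex := by
      simp only [fullVerts, Finset.mem_image, Finset.mem_filter, Finset.mem_univ, true_and]
      exact ⟨d, ⟨hs, ht, hall⟩, rfl⟩
    have h2 : I = S := by
      ext e
      rw [hImem, hS, Finset.mem_filter]
      exact ⟨fun h => ⟨Finset.mem_univ _, h.2⟩, fun h => ⟨hall e h.2, h.2⟩⟩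
    rw [h2, R.sum_vertexRot d, if_pos h1, ← hS]
    have : (0 : ℤ) ≤ 2 * ((R.boundary flex).filter fun e => h e = d.fst).card +
      ((R.boundary flex).filter fun e => h e = d.fst ∧ Compensates G s t flex e.edge).card := by
      positivity
    linarith
  · push Not at hall
    obtain ⟨d', hd'fst, hd'⟩ := hall
    have hsum : ∑ e ∈ I, R.vertexRot e = I.card := by
      rw [Finset.sum_congr rfl fun e he => ?_, Finset.sum_const, nsmul_eq_mul, mul_one]
      obtain ⟨h1, h2⟩ := (hImem e).1 he
      exact vertexRot_eq_one (by rwa [h2]) (by rwa [h2]) (hd'fst.trans h2.symm) h1 hd'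
    have hIS : I ⊆ S.erase d' := by
      intro e he
      obtain ⟨h1, h2⟩ := (hImem e).1 he
      rw [Finset.mem_erase, hS, Finset.mem_filter]
      refine ⟨?_, Finset.mem_univ _, h2⟩
      rintro rfl
      exact hd' h1
    have hcard := Finset.card_le_card hIS
    rw [Finset.card_erase_of_mem (by simpa [hS] using hd'fst)] at hcard
    have hb : 0 < ((R.boundary flex).filter fun e => h e = d.fst).card := by
      obtain ⟨⟨e, he1, he2, he3⟩, e', he1', he2', he3'⟩ := exists_boundary hst hs ht hd'fst hd hd'
      rcases hh with rfl | rfl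
      · exact Finset.card_pos.2 ⟨e, by simp [boundary, he1, he2, he3]⟩
      · exact Finset.card_pos.2 ⟨e'.rev, by simp [boundary, he1', he2', he3']⟩
    have h4 := R.card_darts_le_four d
    rw [← hS] at h4
    rcases h4.eq_or_lt with h4 | h4
    · have hdeg : G.deg d.fst = 4 := by rw [← card_darts_eq_deg, ← h4]
      have hgood : ((R.boundary flex).filter fun e => h e = d.fst ∧
          Compensates G s t flex e.edge) = (R.boundary flex).filter fun e => h e = d.fst := by
        refine Finset.filter_congr fun e _ => and_iff_left_of_imp fun he => ?_
        by_cases hf : flex e.edge = 0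
        · refine Or.inr ⟨e.isLink.edge_mem, hf, d.fst, ?_, Or.inl hdeg⟩
          rw [← he]
          rcases hh with rfl | rfl
          · exact e.isLink.inc_left
          · exact e.isLink.inc_right
        · exact Or.inl hf
      rw [hgood, hsum]
      split_ifs <;> omega
    · rw [hsum]
      split_ifs <;> omega

/-- The angles at a pole, except for the one in the outer face, have a fixed total. -/
lemma pole_bound (o : G.Dart) (hfree : ∀ d : G.Dart, d.fst = o.fst → d ≠ o →
    R.freeRot d = R.vertexRot d) (ho : R.freeRot o = 0) {S : Finset G.Dart}
    (hS : ∀ d ∈ S, d.fst = o.fst) :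
    2 * ((S.erase o).card : ℤ) ≤ ∑ d ∈ S, R.freeRot d + (R.vertexRot o + 2) := by
  set A := Finset.univ.filter fun e : G.Dart => e.fst = o.fst with hA
  have hoA : o ∈ A := by simp [hA]
  have h1 : ∑ d ∈ S, R.freeRot d = ∑ d ∈ S.erase o, R.vertexRot d := by
    rw [← Finset.sum_erase S ho]
    refine Finset.sum_congr rfl fun d hd => ?_
    rw [Finset.mem_erase] at hd
    exact hfree d (hS d hd.2) hd.1
  have h2 : ∑ d ∈ S.erase o, (2 - R.vertexRot d) ≤ ∑ d ∈ A.erase o, (2 - R.vertexRot d) := by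
    refine Finset.sum_le_sum_of_subset_of_nonneg (Finset.erase_subset_erase _ fun d hd => ?_)
      fun d _ _ => ?_
    · simpa [hA] using hS d hd
    · linarith [R.vertexRot_le d]
  have h3 := R.sum_vertexRot o
  rw [← hA, ← Finset.add_sum_erase A _ hoA] at h3
  rw [Finset.sum_sub_distrib, Finset.sum_sub_distrib, Finset.sum_const, Finset.sum_const,
    Finset.card_erase_of_mem hoA, nsmul_eq_mul, nsmul_eq_mul,
    Nat.cast_sub (Finset.card_pos.2 ⟨o, hoA⟩)] at h2
  push_cast at h2
  linarith

/-- The sum of the rotations in all reachable faces. -/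
lemma sum_insideDarts (hst : s ≠ t) (hTS : R.outerTS ∉ R.reach flex) :
    ∑ d ∈ R.insideDarts flex, (R.edgeRot d + R.freeRot d) =
      4 * ((R.reach flex).ncard - 1) + R.rotST := by
  have hfin : (R.reach flex).Finite := Set.toFinite _
  have hST : R.outerST ∈ hfin.toFinset := hfin.mem_toFinset.2 outerST_mem_reach
  have hmaps : ∀ d ∈ R.insideDarts flex, R.node d ∈ hfin.toFinset := fun d hd =>
    hfin.mem_toFinset.2 (Finset.mem_filter.1 hd).2
  rw [← Finset.sum_fiberwise_of_maps_to hmaps]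
  have h1 : ∀ n ∈ hfin.toFinset, ∑ d ∈ R.insideDarts flex with R.node d = n,
      (R.edgeRot d + R.freeRot d) = R.nodeSum n := by
    intro n hn
    refine Finset.sum_congr ?_ fun _ _ => rfl
    ext d
    simp only [insideDarts, Finset.mem_filter, Finset.mem_univ, true_and, and_iff_right_iff_imp]
    rintro rfl
    exact hfin.mem_toFinset.1 hn
  rw [Finset.sum_congr rfl h1, ← Finset.add_sum_erase _ _ hST, R.nodeSum_outerST hst]
  have h2 : ∀ n ∈ hfin.toFinset.erase R.outerST, R.nodeSum n = 4 := by
    rintro ⟨f, b⟩ hn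
    rw [Finset.mem_erase, hfin.mem_toFinset] at hn
    obtain ⟨hf, hb⟩ := node_mem_of_mem_reach hst hTS hn.2 hn.1
    obtain rfl : b = false := hb
    exact R.nodeSum_of_ne hf
  rw [Finset.sum_congr rfl h2, Finset.sum_const, Finset.card_erase_of_mem hST, nsmul_eq_mul,
    Nat.cast_sub (Finset.card_pos.2 ⟨_, hST⟩), Set.ncard_eq_toFinset_card _ hfin]
  push_cast
  ring

lemma card_insideDarts :
    (R.insideDarts flex).card = (R.interiorDarts flex).card + (R.boundary flex).card := by
  rw [insideDarts, ← Finset.card_filter_add_card_filter_not (fun d => R.Inside flex d.rev),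
    Finset.filter_filter, Finset.filter_filter]
  rfl

/-- The rotations at interior edges cancel; the edges of the boundary are bent as far as
possible. -/
lemma sum_edgeRot_insideDarts (hR : R.IsValid flex) :
    ∑ d ∈ R.insideDarts flex, R.edgeRot d = ∑ d ∈ R.boundary flex, (flex d.edge : ℤ) := by
  rw [← Finset.sum_filter_add_sum_filter_not _ (fun d => R.Inside flex d.rev)]
  have h1 : ∑ d ∈ R.insideDarts flex with R.Inside flex d.rev, R.edgeRot d = 0 := by
    have h : ∑ d ∈ R.insideDarts flex with R.Inside flex d.rev, R.edgeRot d =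
        ∑ d ∈ R.insideDarts flex with R.Inside flex d.rev, R.edgeRot d.rev := by
      refine Finset.sum_nbij' Dart.rev Dart.rev ?_ ?_ ?_ ?_ ?_ <;>
        simp +contextual [insideDarts]
    have h' : ∑ d ∈ R.insideDarts flex with R.Inside flex d.rev,
        (R.edgeRot d + R.edgeRot d.rev) = 0 :=
      Finset.sum_eq_zero fun d _ => R.edgeRot_rev d
    rw [Finset.sum_add_distrib, ← h] at h'
    linarith
  rw [h1, zero_add, insideDarts, Finset.filter_filter]
  refine Finset.sum_congr rfl fun d hd => ?_
  rw [boundary, Finset.mem_filter] at hd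
  exact edgeRot_eq_flex hR hd.2.1 hd.2.2

/-- Every edge occurs on the boundary in one direction only. So at most `k` of its edges are
critical, and each other compensating edge has at least one bend. -/
lemma card_compensates_le {k : ℕ} (hk : G.IsKCritical s t flex k) :
    (((R.boundary flex).filter fun d => Compensates G s t flex d.edge).card : ℤ) ≤
      ∑ d ∈ R.boundary flex, (flex d.edge : ℤ) + k := by
  have h1 : ((R.boundary flex).filter fun d => Compensates G s t flex d.edge).card ≤
      ((R.boundary flex).filter fun d => flex d.edge ≠ 0).card +
      ((R.boundary flex).filter fun d => G.IsCritical s t flex d.edge).card := by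
    refine (Finset.card_le_card ?_).trans (Finset.card_union_le _ _)
    rw [← Finset.filter_or]
    intro d hd
    rw [Finset.mem_filter] at hd ⊢
    exact hd
  have h2 : ((R.boundary flex).filter fun d => flex d.edge ≠ 0).card ≤
      ∑ d ∈ R.boundary flex, flex d.edge := by
    rw [Finset.card_filter]
    refine Finset.sum_le_sum fun d _ => ?_
    split_ifs <;> omega
  have h3 : ((R.boundary flex).filter fun d => G.IsCritical s t flex d.edge).card ≤ k := by
    rw [← hk, ← Set.ncard_coe_finset]
    refine Set.ncard_le_ncard_of_injOn Dart.edge (fun d hd => ?_) ?_ (Set.toFinite _)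
    · rw [Finset.mem_coe, Finset.mem_filter] at hd
      exact hd.2
    · intro d hd d' hd' he
      rw [Finset.mem_coe, Finset.mem_filter, boundary, Finset.mem_filter] at hd hd'
      have hl := d'.isLink
      rw [← he] at hl
      rcases d.isLink.eq_and_eq_or_eq_and_eq hl with ⟨ha, hb⟩ | ⟨ha, hb⟩
      · exact Dart.ext he ha hb
      · have : d' = d.rev := Dart.ext he.symm hb.symm ha.symm
        rw [this] at hd'
        exact absurd hd'.1.2.1 hd.1.2.2
  zify at h1 h2 h3
  linarith

/-- If the rotation of `π(s, t)` cannot be increased, then it is not too small. The pole `p` is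
`s` or `t`; every vertex is charged to the boundary edges that leave it or to those that enter it,
respectively. Nothing is charged to the boundary edges that leave `s` or enter `t`, respectively.
Such an edge exists, and it compensates if `p` has degree at least `2`. -/
lemma neg_rotST_le (hG : G.Loopless) (hs : s ∈ G.vertexSet) (hst : s ≠ t) (hR : R.IsValid flex)
    {k : ℕ} (hk : G.IsKCritical s t flex k) (hTS : R.outerTS ∉ R.reach flex)
    {p : V} {h : G.Dart → V} (hp : (p = s ∧ h = Dart.fst) ∨ (p = t ∧ h = Dart.snd)) :
    -R.rotST ≤ k + (R.vertexRot R.sOut + 2) + (R.vertexRot R.tOut + 2) -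
      if 2 ≤ G.deg p then 1 else 0 := by
  have := Fintype.ofFinite V
  have hh : h = Dart.fst ∨ h = Dart.snd := hp.imp And.right And.right
  set I := R.insideDarts flex with hI
  set B := R.boundary flex with hB
  set b : V → ℤ := fun v => ((B.filter fun d => h d = v).card : ℤ) with hb
  set g : V → ℤ := fun v =>
    ((B.filter fun d => h d = v ∧ Compensates G s t flex d.edge).card : ℤ) with hg
  have hb0 : ∀ v, 0 ≤ b v := fun v => Nat.cast_nonneg _
  have hg0 : ∀ v, 0 ≤ g v := fun v => Nat.cast_nonneg _
  -- The contribution of every vertex to the sum of the rotations.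
  have hvertex : ∀ v : V, 2 * ((I.filter fun d => d.fst = v).card : ℤ) -
      4 * (if v ∈ R.fullVerts flex then 1 else 0) - 2 * b v - g v +
      ((if v = s then 2 * b s + g s - 2 - (R.vertexRot R.sOut + 2) else 0) +
        if v = t then 2 * b t + g t - (R.vertexRot R.tOut + 2) else 0) ≤
      ∑ d ∈ I with d.fst = v, R.freeRot d := by
    intro v
    by_cases hvs : v = s
    · subst hvs
      have h1 := R.pole_bound R.sOut (S := I.filter fun d => d.fst = v)
        (fun d hd hne => by
          have : d ≠ R.tOut := fun h' => hst (by
            rw [← R.tOut_fst, ← h', hd, R.sOut_fst])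
          simp [freeRot, hne, this])
        (by simp [freeRot])
        (fun d hd => (Finset.mem_filter.1 hd).2.trans R.sOut_fst.symm)
      have h2 : R.sOut ∈ I.filter fun d => d.fst = v :=
        Finset.mem_filter.2 ⟨Finset.mem_filter.2 ⟨Finset.mem_univ _, inside_sOut hst⟩,
          R.sOut_fst⟩
      rw [Finset.card_erase_of_mem h2, Nat.cast_sub (Finset.card_pos.2 ⟨_, h2⟩)] at h1
      rw [if_pos rfl, if_neg hst]
      push_cast at h1
      split_ifs <;> linarith
    by_cases hvt : v = t
    · subst hvt
      have h1 := R.pole_bound R.tOut (S := I.filter fun d => d.fst = v)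
        (fun d hd hne => by
          have : d ≠ R.sOut := fun h' => hst (by
            rw [← R.sOut_fst, ← h', hd, R.tOut_fst])
          simp [freeRot, hne, this])
        (by simp [freeRot])
        (fun d hd => (Finset.mem_filter.1 hd).2.trans R.tOut_fst.symm)
      have h2 : R.tOut ∉ I.filter fun d => d.fst = v := fun h' =>
        not_inside_tOut hst hTS (Finset.mem_filter.1 (Finset.mem_filter.1 h').1).2
      rw [Finset.erase_eq_of_notMem h2] at h1
      rw [if_neg hvs, if_pos rfl]
      split_ifs <;> linarith
    · have h1 := R.vertex_bound (flex := flex) hst hh hvs hvt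
      have h2 : ∑ d ∈ I with d.fst = v, R.freeRot d = ∑ d ∈ I with d.fst = v, R.vertexRot d := by
        refine Finset.sum_congr rfl fun d hd => ?_
        have hd' := (Finset.mem_filter.1 hd).2
        have e1 : d ≠ R.sOut := fun h' => hvs (by rw [← hd', h', R.sOut_fst])
        have e2 : d ≠ R.tOut := fun h' => hvt (by rw [← hd', h', R.tOut_fst])
        simp [freeRot, e1, e2]
      rw [h2, if_neg hvs, if_neg hvt]
      simp only [hb, hg]
      linarith
  have hsum := Finset.sum_le_sum fun v (_ : v ∈ Finset.univ) => hvertex v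
  rw [Finset.sum_fiberwise I Dart.fst R.freeRot] at hsum
  simp only [Finset.sum_add_distrib, Finset.sum_sub_distrib, ← Finset.mul_sum,
    Finset.sum_ite_eq', Finset.mem_univ, if_true] at hsum
  have hIc : ∑ v : V, ((I.filter fun d => d.fst = v).card : ℤ) = I.card := by
    rw [Finset.card_eq_sum_card_fiberwise (f := Dart.fst) (t := Finset.univ)
      fun _ _ => Finset.mem_coe.2 (Finset.mem_univ _)]
    push_cast
    rfl
  have hUc : ∑ v : V, (if v ∈ R.fullVerts flex then (1 : ℤ) else 0) =
      (R.fullVerts flex).card := by simp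
  have hbc : ∑ v : V, b v = B.card := by
    rw [Finset.card_eq_sum_card_fiberwise (f := h) (t := Finset.univ)
      fun _ _ => Finset.mem_coe.2 (Finset.mem_univ _)]
    push_cast
    rfl
  have hgc : ∑ v : V, g v = (B.filter fun d => Compensates G s t flex d.edge).card := by
    rw [Finset.card_eq_sum_card_fiberwise (f := h) (t := Finset.univ)
      fun _ _ => Finset.mem_coe.2 (Finset.mem_univ _)]
    push_cast
    refine Finset.sum_congr rfl fun v _ => ?_
    rw [Finset.filter_filter]
    simp only [hg, and_comm]
  rw [hIc, hUc, hbc, hgc] at hsum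
  have hface := R.sum_insideDarts (flex := flex) hst hTS
  rw [Finset.sum_add_distrib, sum_edgeRot_insideDarts hR, ← hI, ← hB] at hface
  have hcomp := R.card_compensates_le hk
  rw [← hB] at hcomp
  have htree := R.card_fullVerts_le hG hs hst hTS
  have hcard := R.card_insideDarts (flex := flex)
  rw [← hI, ← hB] at hcard
  zify at htree hcard
  -- The boundary darts `e` with `h e = p` are charged by no vertex.
  have hbp : 1 ≤ b p := by
    simp only [hb]
    rcases hp with ⟨rfl, rfl⟩ | ⟨rfl, rfl⟩
    · obtain ⟨e, h1, h2, h3⟩ := R.exists_boundary_left hst hTS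
      exact_mod_cast Finset.card_pos.2 ⟨e, by simp [hB, boundary, h1, h2, h3]⟩
    · obtain ⟨e, h1, h2, h3⟩ := R.exists_boundary_right hst hTS
      exact_mod_cast Finset.card_pos.2 ⟨e.rev, by simp [hB, boundary, h1, h2, h3]⟩
  have hgp : (if 2 ≤ G.deg p then 1 else 0) ≤ g p := by
    split_ifs with hdeg
    · have : g p = b p := by
        simp only [hg, hb]
        congr 2
        refine Finset.filter_congr fun e _ => and_iff_left_of_imp fun he => ?_
        by_cases hf : flex e.edge = 0
        · refine Or.inr ⟨e.isLink.edge_mem, hf, p, ?_, Or.inr ⟨hp.imp And.left And.left, hdeg⟩⟩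
          rw [← he]
          rcases hh with rfl | rfl
          · exact e.isLink.inc_left
          · exact e.isLink.inc_right
        · exact Or.inl hf
      linarith
    · exact hg0 p
  have hpole : 2 + (if 2 ≤ G.deg p then 1 else 0) ≤ 2 * b s + g s + 2 * b t + g t := by
    rcases hp with ⟨rfl, -⟩ | ⟨rfl, -⟩
    · linarith [hb0 t, hg0 t]
    · linarith [hb0 s, hg0 s]
  linarith

end OrthogonalRepresentation

namespace OrthogonalRepresentation

variable {V E : Type*} [Finite V] [Finite E] {G : Graph V E} {s t : V}
  {R : G.OrthogonalRepresentation s t} {flex : E → ℕ}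

/-! ### Reducing the number of bends -/

open Classical in
/-- A vertex of degree `1` has a single angle. -/
lemma vertexRot_of_deg_le_one {d : G.Dart} (h : G.deg d.fst ≤ 1) : R.vertexRot d = -2 := by
  have hmem : d ∈ Finset.univ.filter fun e : G.Dart => e.fst = d.fst := by simp
  have hsum := R.sum_vertexRot d
  rw [← card_darts_eq_deg] at h
  have hcard := le_antisymm h (Finset.card_pos.2 ⟨d, hmem⟩)
  rw [hcard] at hsum
  obtain ⟨e, he⟩ := Finset.card_eq_one.1 hcard
  rw [he, Finset.mem_singleton] at hmem
  subst hmem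
  rw [he, Finset.sum_singleton] at hsum
  simpa using hsum

lemma neg_rotST_le_max (hG : G.Loopless) (hs : s ∈ G.vertexSet) (hst : s ≠ t)
    (hR : R.IsValid flex) {k : ℕ} (hk : G.IsKCritical s t flex k)
    (hTS : R.outerTS ∉ R.reach flex) {σ τ : ℕ} (hRt : R.HasType σ τ) :
    -R.rotST ≤ k + max 0 ((σ : ℤ) + τ - 3) := by
  obtain ⟨h1, h2⟩ := hRt
  have hl := R.neg_rotST_le hG hs hst hR hk hTS (Or.inl ⟨rfl, rfl⟩)
  have hr := R.neg_rotST_le hG hs hst hR hk hTS (Or.inr ⟨rfl, rfl⟩)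
  by_cases hds : 2 ≤ G.deg s
  · rw [if_pos hds] at hl
    omega
  by_cases hdt : 2 ≤ G.deg t
  · rw [if_pos hdt] at hr
    omega
  · rw [if_neg hds] at hl
    have e1 : R.vertexRot R.sOut = -2 := R.vertexRot_of_deg_le_one (by rw [R.sOut_fst]; omega)
    have e2 : R.vertexRot R.tOut = -2 := R.vertexRot_of_deg_le_one (by rw [R.tOut_fst]; omega)
    omega

lemma rotST_add_rotTS_of_hasType (hst : s ≠ t) {σ τ : ℕ} (hRt : R.HasType σ τ) :
    R.rotST + R.rotTS = 2 - σ - τ ∧ 2 ≤ σ + τ := by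
  obtain ⟨h1, h2⟩ := hRt
  have h := R.rotST_add_rotTS hst
  have h3 := (R.vertexRot_mem R.sOut).1
  have h4 := (R.vertexRot_mem R.tOut).1
  constructor <;> omega

lemma exists_bends_sub_one_of_le (hG : G.Loopless) (hs : s ∈ G.vertexSet) (hst : s ≠ t)
    (hR : R.IsValid flex) {k : ℕ} (hk : G.IsKCritical s t flex k) {σ τ : ℕ}
    (hRt : R.HasType σ τ) (hle : R.rotST ≤ R.rotTS) (h1 : k + max 0 ((σ : ℤ) + τ - 3) < R.bends)
    (h2 : (σ : ℤ) + τ ≤ 2 * R.bends) :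
    ∃ R' : G.OrthogonalRepresentation s t, R'.IsValid flex ∧ R'.HasType σ τ ∧
      R'.bends = R.bends - 1 := by
  obtain ⟨hsum, hpos⟩ := rotST_add_rotTS_of_hasType hst hRt
  have hb : R.bends = -R.rotST := by
    rw [bends, abs_of_nonpos (a := R.rotST) (by omega)]
    exact max_eq_left (abs_le.2 ⟨by omega, by omega⟩)
  by_cases hTS : R.outerTS ∈ R.reach flex
  · obtain ⟨R', hR', e1, e2, e3, e4⟩ := R.exists_augmentation hst hR hTS
    refine ⟨R', hR', ⟨e1.trans hRt.1, e2.trans hRt.2⟩, ?_⟩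
    rw [bends, e3, e4, abs_of_nonpos (a := R.rotST + 1) (by omega), hb]
    rw [max_eq_left (abs_le.2 ⟨by omega, by omega⟩)]
    ring
  · have := neg_rotST_le_max hG hs hst hR hk hTS hRt
    omega

lemma swap_bends : R.swap.bends = R.bends := max_comm _ _

/-- As long as the number of bends is large enough, it can be reduced by one. -/
lemma exists_bends_sub_one (hG : G.IsStGraph s t) (hR : R.IsValid flex) {k : ℕ}
    (hk : G.IsKCritical s t flex k) {σ τ : ℕ} (hRt : R.HasType σ τ)
    (h1 : k + max 0 ((σ : ℤ) + τ - 3) < R.bends) (h2 : (σ : ℤ) + τ ≤ 2 * R.bends) :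
    ∃ R' : G.OrthogonalRepresentation s t, R'.IsValid flex ∧ R'.HasType σ τ ∧
      R'.bends = R.bends - 1 := by
  rcases le_total R.rotST R.rotTS with hle | hle
  · exact exists_bends_sub_one_of_le hG.loopless hG.left_mem hG.ne hR hk hRt hle h1 h2
  · have hk' : G.IsKCritical t s flex k := by
      rw [← hk]
      simp only [IsKCritical, IsCritical, or_comm (a := _ = t)]
    obtain ⟨R', hR', hR't, hb⟩ := exists_bends_sub_one_of_le (R := R.swap) hG.loopless
      hG.right_mem hG.ne.symm hR hk' (σ := τ) (τ := σ) ⟨hRt.2, hRt.1⟩ hle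
      (by rwa [swap_bends, add_comm (τ : ℤ)]) (by rwa [swap_bends, add_comm (τ : ℤ)])
    exact ⟨R'.swap, hR', ⟨hR't.2, hR't.1⟩, by rw [swap_bends, hb, swap_bends]⟩

lemma bends_le (hst : s ≠ t) (hR : R.IsValid flex) :
    R.bends ≤ ∑ d : G.Dart, ((flex d.edge : ℤ) + 2) := by
  classical
  have hnode : ∀ n, |R.nodeSum n| ≤ ∑ d : G.Dart, ((flex d.edge : ℤ) + 2) := by
    intro n
    refine (Finset.abs_sum_le_sum_abs _ _).trans ((Finset.sum_le_sum fun d _ => ?_).trans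
      (Finset.sum_le_sum_of_subset_of_nonneg (Finset.filter_subset _ _)
        fun d _ _ => by positivity))
    refine (abs_add_le _ _).trans (add_le_add (hR d) ?_)
    have hd := R.vertexRot_mem d
    rw [freeRot]
    split_ifs
    · simp
    · exact abs_le.2 ⟨hd.1, hd.2.trans (by norm_num)⟩
  rw [bends, ← R.nodeSum_outerST hst, ← R.nodeSum_outerTS hst]
  exact max_le (hnode _) (hnode _)

end OrthogonalRepresentation

variable {V E : Type*} [Finite V] [Finite E] {G : Graph V E} {s t : V} {flex : E → ℕ} {σ τ : ℕ}

lemma add_le_two_mul_betaLow (σ τ : ℕ) : (σ : ℤ) + τ ≤ 2 * betaLow σ τ + 2 := by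
  have h := Int.le_ceil (((σ : ℚ) + (τ : ℚ)) / 2)
  have h' : (σ : ℚ) + τ ≤ 2 * (⌈((σ : ℚ) + (τ : ℚ)) / 2⌉ : ℚ) := by linarith
  have h'' : (σ : ℤ) + τ ≤ 2 * ⌈((σ : ℚ) + (τ : ℚ)) / 2⌉ := by exact_mod_cast h'
  rw [betaLow]
  linarith

lemma isGreatest_betaMax (hst : s ≠ t) (hne : (G.bendSet s t flex σ τ).Nonempty) :
    IsGreatest (G.bendSet s t flex σ τ) (G.betaMax s t flex σ τ) := by
  have hbdd : BddAbove (G.bendSet s t flex σ τ) := by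
    refine ⟨∑ d : G.Dart, ((flex d.edge : ℤ) + 2), ?_⟩
    rintro _ ⟨R, hR, -, rfl⟩
    exact R.bends_le hst hR
  exact ⟨Int.csSup_mem hne hbdd, fun b hb => le_csSup hbdd hb⟩

lemma isLeast_sInf_fullSet (hst : s ≠ t) (hne : (G.bendSet s t flex σ τ).Nonempty) :
    IsLeast (G.fullSet s t flex σ τ) (sInf (G.fullSet s t flex σ τ)) := by
  have hmax := isGreatest_betaMax hst hne
  have hne' : (G.fullSet s t flex σ τ).Nonempty := by
    refine ⟨G.betaMax s t flex σ τ, hmax.1, ?_⟩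
    rw [Set.Icc_self, Set.singleton_subset_iff]
    exact hmax.1
  have hbdd : BddBelow (G.fullSet s t flex σ τ) := by
    refine ⟨0, ?_⟩
    rintro _ ⟨⟨R, -, -, rfl⟩, -⟩
    exact le_max_of_le_left (abs_nonneg _)
  exact ⟨Int.csInf_mem hne' hbdd, fun b hb => csInf_le hbdd hb⟩

/-- Starting from the maximum, the bend value is reduced by one until it reaches `c`. -/
lemma Icc_subset_bendSet (hG : G.IsStGraph s t) {k : ℕ} (hk : G.IsKCritical s t flex k)
    (hne : (G.bendSet s t flex σ τ).Nonempty) {c : ℤ}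
    (hc : betaLow σ τ ≤ c) (hc' : k + max 0 ((σ : ℤ) + τ - 3) ≤ c) :
    Set.Icc c (G.betaMax s t flex σ τ) ⊆ G.bendSet s t flex σ τ := by
  have hlow := add_le_two_mul_betaLow σ τ
  intro b hb
  refine Int.leInductionDown (m := G.betaMax s t flex σ τ)
    (motive := fun b _ => c ≤ b → b ∈ G.bendSet s t flex σ τ)
    (fun _ => (isGreatest_betaMax hG.ne hne).1) (fun n _ ih hn => ?_) b hb.2 hb.1
  obtain ⟨R, hR, hRt, rfl⟩ := ih (by omega)
  obtain ⟨R', h1, h2, h3⟩ := R.exists_bends_sub_one hG hR hk hRt (by omega) (by omega)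
  exact ⟨R', h1, h2, h3⟩

lemma gap_le (hst : s ≠ t) (hne : (G.bendSet s t flex σ τ).Nonempty) {c : ℤ}
    (hc : Set.Icc (betaLow σ τ + c) (G.betaMax s t flex σ τ) ⊆ G.bendSet s t flex σ τ) :
    G.gap s t flex σ τ ≤ c := by
  have hleast := isLeast_sInf_fullSet hst hne
  have hmax := isGreatest_betaMax hst hne
  rw [gap, sub_le_iff_le_add']
  rcases le_or_gt (betaLow σ τ + c) (G.betaMax s t flex σ τ) with h | h
  · exact hleast.2 ⟨hc ⟨le_rfl, h⟩, hc⟩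
  · exact (hmax.2 hleast.1.1).trans h.le

end Graph

theorem mainTheorem3 {V E : Type*} [Finite V] [Finite E] (G : Graph V E) (s t : V)
    (hG : G.IsStGraph s t) (flex : E → ℕ) (k : ℕ) (hk : G.IsKCritical s t flex k)
    (σ τ : ℕ) (hne : (G.bendSet s t flex σ τ).Nonempty) :
    IsGreatest (G.bendSet s t flex σ τ) (G.betaMax s t flex σ τ) ∧
    IsLeast (G.fullSet s t flex σ τ) (Graph.betaLow σ τ + G.gap s t flex σ τ) ∧
    (σ + τ ≤ 5 →
      G.gap s t flex σ τ ≤ k ∧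
      Set.Icc (Graph.betaLow σ τ + k) (G.betaMax s t flex σ τ) ⊆ G.bendSet s t flex σ τ) ∧
    (σ = 3 → τ = 3 →
      G.gap s t flex σ τ ≤ k + 1 ∧
      Set.Icc (Graph.betaLow σ τ + k + 1) (G.betaMax s t flex σ τ) ⊆
        G.bendSet s t flex σ τ) := by
  have hmax := Graph.isGreatest_betaMax hG.ne hne
  have hpos : 2 ≤ σ + τ := by
    obtain ⟨_, R, -, hRt, -⟩ := hne
    exact (R.rotST_add_rotTS_of_hasType hG.ne hRt).2
  have hlow := Graph.add_le_two_mul_betaLow σ τ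
  refine ⟨hmax, ?_, fun h => ?_, fun h3 h3' => ?_⟩
  · rw [Graph.gap, add_sub_cancel]
    exact Graph.isLeast_sInf_fullSet hG.ne hne
  · have hsub := Graph.Icc_subset_bendSet hG hk hne (c := Graph.betaLow σ τ + k)
      (by omega) (by omega)
    exact ⟨Graph.gap_le hG.ne hne hsub, hsub⟩
  · have hsub := Graph.Icc_subset_bendSet hG hk hne (c := Graph.betaLow σ τ + k + 1)
      (by omega) (by omega)
    exact ⟨Graph.gap_le hG.ne hne (by rwa [← add_assoc]), hsub⟩
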